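/- Let $\Omega=[0,2\pi]\times[0,2\pi]$, let $\gamma>0$, $\gamma_2>0$ and $\gamma_1\in\mathbb R$, and let $\varphi(s)=\gamma_2s^3+\gamma_1s^2-s$, so that $\varphi'(s)=3\gamma_2s^2+2\gamma_1s-1$. Write $(\cdot,\cdot)$, $\|\cdot\|$ and $\|\cdot\|_\infty$ for the inner product and norm of $L^2(\Omega)$ and the norm of $L^\infty(\Omega)$, and $\nabla\cdot f=f_x+f_y$ for scalar functions $f$. For a positive integer $2N$ let $S_N=\operatorname{span}\{\sin k_1x\,\sin k_2y : k_1,k_2=1,\dots,2N\}$, and let $P_N:L^2(\Omega)\to S_N$ be the $L^2$-orthogonal projection. For $T>0$ and a positive integer $M$ let $\Delta t=T/M$. A solution of the fully discrete scheme is a family $u_N^0,\dots,u_N^M\in S_N$ such that $u_N^0=P_Nu_0$ and, for all $k=1,\dots,M$ and all $v_N\in S_N$, $$\Big(\frac{u_N^k-u_N^{k-1}}{\Delta t},v_N\Big)+\gamma(\Delta u_N^k,\Delta v_N)+(\varphi'(u_N^{k-1})\nabla u_N^k,\nabla v_N)-\tfrac23(u_N^{k-1}\nabla\cdot u_N^k,v_N)+\tfrac23(u_N^{k-1}u_N^k,\nabla\cdot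 v_N)=0 .$$ Lemma. There is $\tau_0>0$ depending only on $\gamma,\gamma_1,\gamma_2$ such that, for every $u_0\in H^2(\Omega)\cap H_0^1(\Omega)$, there are positive constants $c_{15},c_{16},c_{17},c_{18}$ depending only on $\gamma,\gamma_1,\gamma_2$ and $u_0$ with the following property: for all $N$, $T$ and $M$ with $\Delta t=T/M\le\tau_0$, every solution of the scheme satisfies, for all $k=0,1,\dots,M$, $$\|u_N^k\|\le c_{15},\qquad \|\nabla u_N^k\|\le c_{16},\qquad \|\Delta u_N^k\|\le c_{17},\qquad \|u_N^k\|_\infty\le c_{18}.$$ -/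

import Mathlib

open MeasureTheory Filter Topology
open scoped ENNReal ContDiff

noncomputable section

namespace CCH

/-- The square `Ω = [0, 2π] × [0, 2π]`. -/
def square : Set (ℝ × ℝ) :=
  Set.Icc 0 (2 * Real.pi) ×ˢ Set.Icc 0 (2 * Real.pi)

/-- Lebesgue measure on the square. -/
def area : Measure (ℝ × ℝ) := volume.restrict square

/-- First partial derivative. -/
def dx (f : ℝ × ℝ → ℝ) (p : ℝ × ℝ) : ℝ := fderiv ℝ f p (1, 0)

/-- Second partial derivative. -/
def dy (f : ℝ × ℝ → ℝ) (p : ℝ × ℝ) : ℝ := fderiv ℝ f p (0, 1)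

/-- The gradient, with the Euclidean norm on its values. -/
def grad (f : ℝ × ℝ → ℝ) (p : ℝ × ℝ) : EuclideanSpace ℝ (Fin 2) := !₂[dx f p, dy f p]

/-- The Laplacian. -/
def lap (f : ℝ × ℝ → ℝ) (p : ℝ × ℝ) : ℝ := dx (dx f) p + dy (dy f) p

/-- `∇ · f` of a scalar function, that is, `f_x + f_y`. -/
def sdiv (f : ℝ × ℝ → ℝ) (p : ℝ × ℝ) : ℝ := dx f p + dy f p

/-- The inner product of `L²(Ω)`. -/
def ip (f g : ℝ × ℝ → ℝ) : ℝ := ∫ p, f p * g p ∂area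

/-! ### Sobolev spaces on the square -/

/-- Test functions: smooth, with compact support inside the open square. -/
def IsTest (η : ℝ × ℝ → ℝ) : Prop :=
  ContDiff ℝ ∞ η ∧ HasCompactSupport η ∧ tsupport η ⊆ interior square

/-- `g` and `h` are the weak partial derivatives of `f` on the square. -/
def IsWeakGrad (f g h : ℝ × ℝ → ℝ) : Prop :=
  ∀ η, IsTest η → ip f (dx η) = -ip g η ∧ ip f (dy η) = -ip h η

/-- `f ∈ H¹(Ω)`. -/
def MemH1 (f : ℝ × ℝ → ℝ) : Prop :=
  MemLp f 2 area ∧ ∃ g h, MemLp g 2 area ∧ MemLp h 2 area ∧ IsWeakGrad f g h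

/-- `f ∈ H²(Ω)`. -/
def MemH2 (f : ℝ × ℝ → ℝ) : Prop :=
  MemLp f 2 area ∧ ∃ g h, MemH1 g ∧ MemH1 h ∧ IsWeakGrad f g h

/-- `f ∈ H¹₀(Ω)`, the closure of the test functions in `H¹(Ω)`. -/
def MemH10 (f : ℝ × ℝ → ℝ) : Prop :=
  MemLp f 2 area ∧ ∃ g h, MemLp g 2 area ∧ MemLp h 2 area ∧ IsWeakGrad f g h ∧
    ∃ η : ℕ → ℝ × ℝ → ℝ, (∀ n, IsTest (η n)) ∧
      Tendsto (fun n => eLpNorm (f - η n) 2 area) atTop (𝓝 0) ∧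
      Tendsto (fun n => eLpNorm (g - dx (η n)) 2 area) atTop (𝓝 0) ∧
      Tendsto (fun n => eLpNorm (h - dy (η n)) 2 area) atTop (𝓝 0)

/-! ### The fully discrete scheme -/

/-- The function `sin (k₁ x) sin (k₂ y)`. -/
def sinMode (k₁ k₂ : ℕ) (p : ℝ × ℝ) : ℝ := Real.sin (k₁ * p.1) * Real.sin (k₂ * p.2)

/-- The spectral space `S_N`, spanned by the modes with `1 ≤ k₁, k₂ ≤ m`, where `m = 2N`. -/
def specSpace (m : ℕ) : Submodule ℝ (ℝ × ℝ → ℝ) :=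
  Submodule.span ℝ {f | ∃ k₁ ∈ Finset.Icc 1 m, ∃ k₂ ∈ Finset.Icc 1 m, f = sinMode k₁ k₂}

/-- The nonlinearity `φ(s) = γ₂ s³ + γ₁ s² - s`. -/
def phi (γ₁ γ₂ s : ℝ) : ℝ := γ₂ * s ^ 3 + γ₁ * s ^ 2 - s

/-- `w` is the `L²(Ω)`-orthogonal projection of `u₀` onto `S_N`. -/
def IsProj (m : ℕ) (u₀ w : ℝ × ℝ → ℝ) : Prop :=
  w ∈ specSpace m ∧ ∀ v ∈ specSpace m, ip (u₀ - w) v = 0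

/-- One step of the scheme, from `a` at the old time level to `b` at the new one. -/
def IsStep (γ γ₁ γ₂ : ℝ) (m : ℕ) (Δt : ℝ) (a b : ℝ × ℝ → ℝ) : Prop :=
  ∀ v ∈ specSpace m,
    ip (fun p => (b p - a p) / Δt) v + γ * ip (lap b) (lap v)
      + (∫ p, deriv (phi γ₁ γ₂) (a p) * (dx b p * dx v p + dy b p * dy v p) ∂area)
      - 2 / 3 * ip (fun p => a p * sdiv b p) v
      + 2 / 3 * ip (fun p => a p * b p) (sdiv v) = 0

/-- `u 0, …, u M` is a solution of the fully discrete scheme on `[0, T]` with `Δt = T / M`,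
started from the projection of `u₀`. -/
def IsDiscreteSolution (γ γ₁ γ₂ : ℝ) (m : ℕ) (T : ℝ) (M : ℕ) (u₀ : ℝ × ℝ → ℝ)
    (u : ℕ → ℝ × ℝ → ℝ) : Prop :=
  IsProj m u₀ (u 0) ∧ (∀ k ≤ M, u k ∈ specSpace m) ∧
    ∀ k < M, IsStep γ γ₁ γ₂ m (T / M) (u k) (u (k + 1))

end CCH

end

/-!
The modes of the scheme are smooth, `2π`-periodic and vanish on the boundary of the square, so
integration by parts in the spectral space has no boundary terms. The bounds are uniform in `T`
because each of two functionals, along one step of the scheme, cannot grow once it exceeds a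
threshold.

The first functional is `‖u‖²`. Testing the scheme with the new iterate `b`, the convective terms
cancel and the nonlinear diffusion gives the damping `∫ a² |∇b|²`, with the *old* iterate `a` as
weight, against the linear instability `‖∇b‖²` (`CCH.IsStep.energy`). Writing
`‖b‖² = -2 ∫ (x - π) b b_x` and replacing the factor `b` by `a` bounds `‖b‖⁴` by the damping plus
`‖∇b‖² ‖b - a‖²` (`CCH.ip_self_sq_le`). If `‖b‖² > ‖a‖²`, the energy inequality makes `‖b - a‖²` at
most of order `Δt ‖b‖²` and `‖∇b‖²` at most of order `‖b‖²`, so for `Δt` below a threshold that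
depends only on the coefficients the damping is of order `‖b‖⁴`, which is impossible when `‖b‖` is large (`CCH.exists_absorbing`).

The second functional is `log (1 + ‖Δu‖²) + l ‖u‖²` with `l` large. Testing with `Δ² b`, absorbing
`‖Δ² b‖²` and using Agmon and Gagliardo–Nirenberg inequalities (`CCH.pow_four_le`,
`CCH.quartic_le`) shows that, if `‖Δb‖ ≥ ‖Δa‖`, then
`‖Δb‖² - ‖Δa‖² ≲ Δt (1 + ‖Δa‖²) (1 + ‖Δb‖²)` (`CCH.ip_lowerOrder_le`). Hence the logarithm grows by
at most a multiple of `Δt (1 + ‖Δb‖²)`, with no smallness condition on `Δt`, and the dissipation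
`γ Δt ‖Δb‖²` of the `L²` estimate pays for this (`CCH.log_add_le_max`). The remaining norms follow
by interpolation.

For the initial step, `u₀ ∈ H² ∩ H¹₀` has a weak Laplacian in `L²` that can be tested against the
modes (`CCH.exists_weak_lap`), so the Laplacian of the projection of `u₀` is the projection of the
Laplacian and is bounded independently of the spectral space (`CCH.exists_proj_bound`).
-/

namespace CCH

/-! ### Calculus of smooth doubly periodic functions -/

/-- The derivative in the direction `v`; `dx` and `dy` are the cases `v = (1, 0)`, `(0, 1)`. -/
noncomputable def pd (v : ℝ × ℝ) (f : ℝ × ℝ → ℝ) (p : ℝ × ℝ) : ℝ := fderiv ℝ f p v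

/-- Smooth functions on the plane that are `2π`-periodic in each variable. -/
structure Per (f : ℝ × ℝ → ℝ) : Prop where
  smooth : ContDiff ℝ ∞ f
  per_x : ∀ p, f (p + (2 * Real.pi, 0)) = f p
  per_y : ∀ p, f (p + (0, 2 * Real.pi)) = f p

lemma dx_eq_pd (f : ℝ × ℝ → ℝ) : dx f = pd (1, 0) f := rfl

lemma dy_eq_pd (f : ℝ × ℝ → ℝ) : dy f = pd (0, 1) f := rfl

section pd
variable {f g : ℝ × ℝ → ℝ} {v : ℝ × ℝ}

lemma smooth_pd (hf : ContDiff ℝ ∞ f) : ContDiff ℝ ∞ (pd v f) :=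
  (hf.fderiv_right (m := ∞) (by simp)).clm_apply contDiff_const

lemma pd_add (hf : ContDiff ℝ ∞ f) (hg : ContDiff ℝ ∞ g) :
    pd v (f + g) = pd v f + pd v g := by
  ext p
  simp only [pd, Pi.add_apply]
  rw [fderiv_add (hf.differentiable (by simp) p) (hg.differentiable (by simp) p)]
  rfl

lemma pd_mul (hf : ContDiff ℝ ∞ f) (hg : ContDiff ℝ ∞ g) :
    pd v (f * g) = pd v f * g + f * pd v g := by
  ext p
  simp only [pd, Pi.add_apply, Pi.mul_apply]
  rw [fderiv_mul (hf.differentiable (by simp) p) (hg.differentiable (by simp) p)]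
  simp
  ring

lemma pd_smul (c : ℝ) (hf : ContDiff ℝ ∞ f) : pd v (c • f) = c • pd v f := by
  ext p
  simp only [pd, Pi.smul_apply]
  rw [fderiv_const_smul (hf.differentiable (by simp) p)]
  rfl

lemma pd_comm (hf : ContDiff ℝ ∞ f) (v w : ℝ × ℝ) : pd v (pd w f) = pd w (pd v f) := by
  ext p
  have hd : DifferentiableAt ℝ (fderiv ℝ f) p :=
    (hf.fderiv_right (m := ∞) (by simp)).differentiable (by simp) p
  have key : ∀ v w : ℝ × ℝ, pd v (pd w f) p = fderiv ℝ (fderiv ℝ f) p v w := by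
    intro v w
    have : pd w f = fun q => (fderiv ℝ f q) w := rfl
    rw [this]
    simp only [pd]
    rw [fderiv_clm_apply hd (differentiableAt_const w)]
    simp
  rw [key, key]
  exact (hf.contDiffAt.isSymmSndFDerivAt (by
    simpa using WithTop.coe_le_coe.2 (le_top : (2 : ℕ∞) ≤ ⊤))).eq v w

end pd

namespace Per
variable {f g : ℝ × ℝ → ℝ}

lemma continuous (hf : Per f) : Continuous f := hf.smooth.continuous

lemma add (hf : Per f) (hg : Per g) : Per (f + g) :=
  ⟨hf.smooth.add hg.smooth, fun p => by simp [hf.per_x, hg.per_x],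
    fun p => by simp [hf.per_y, hg.per_y]⟩

lemma mul (hf : Per f) (hg : Per g) : Per (f * g) :=
  ⟨hf.smooth.mul hg.smooth, fun p => by simp [hf.per_x, hg.per_x],
    fun p => by simp [hf.per_y, hg.per_y]⟩

lemma const_smul (c : ℝ) (hf : Per f) : Per (c • f) :=
  ⟨hf.smooth.const_smul c, fun p => by simp [hf.per_x], fun p => by simp [hf.per_y]⟩

lemma const (c : ℝ) : Per (fun _ => c) := ⟨contDiff_const, fun _ => rfl, fun _ => rfl⟩

lemma sub (hf : Per f) (hg : Per g) : Per (f - g) :=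
  ⟨hf.smooth.sub hg.smooth, fun p => by simp [hf.per_x, hg.per_x],
    fun p => by simp [hf.per_y, hg.per_y]⟩

lemma pd (hf : Per f) (v : ℝ × ℝ) : Per (CCH.pd v f) := by
  refine ⟨smooth_pd hf.smooth, fun p => ?_, fun p => ?_⟩
  · have : (fun q => f (q + (2 * Real.pi, 0))) = f := funext hf.per_x
    simp only [CCH.pd]
    rw [← fderiv_comp_add_right, this]
  · have : (fun q => f (q + (0, 2 * Real.pi))) = f := funext hf.per_y
    simp only [CCH.pd]
    rw [← fderiv_comp_add_right, this]

lemma dx (hf : Per f) : Per (CCH.dx f) := hf.pd (1, 0)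

lemma dy (hf : Per f) : Per (CCH.dy f) := hf.pd (0, 1)

lemma lap (hf : Per f) : Per (CCH.lap f) := hf.dx.dx.add hf.dy.dy

lemma sdiv (hf : Per f) : Per (CCH.sdiv f) := hf.dx.add hf.dy

end Per

/-! ### Integration over the square -/

lemma isCompact_square : IsCompact square := isCompact_Icc.prod isCompact_Icc

lemma measurableSet_square : MeasurableSet square := measurableSet_Icc.prod measurableSet_Icc

instance : IsFiniteMeasure area :=
  ⟨by simpa [area] using isCompact_square.measure_lt_top⟩

lemma area_eq_prod : area = (volume.restrict (Set.Icc 0 (2 * Real.pi))).prod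
    (volume.restrict (Set.Icc 0 (2 * Real.pi))) := by
  rw [Measure.prod_restrict]; rfl

lemma integrable_of_continuous {f : ℝ × ℝ → ℝ} (hf : Continuous f) : Integrable f area :=
  hf.continuousOn.integrableOn_compact isCompact_square

lemma memLp_of_continuous {f : ℝ × ℝ → ℝ} (hf : Continuous f) : MemLp f 2 area :=
  (memLp_two_iff_integrable_sq hf.aestronglyMeasurable).2 (integrable_of_continuous (hf.pow 2))

lemma memLp_integrable_mul {f g : ℝ × ℝ → ℝ} (hf : MemLp f 2 area) (hg : MemLp g 2 area) :
    Integrable (fun p => f p * g p) area := by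
  have := MemLp.integrable_mul hf hg
  exact this

lemma integral_dx_eq_zero {f : ℝ × ℝ → ℝ} (hf : ContDiff ℝ ∞ f)
    (hb : ∀ y ∈ Set.Icc 0 (2 * Real.pi), f (0, y) = f (2 * Real.pi, y)) :
    ∫ p, dx f p ∂area = 0 := by
  have hc : Continuous (dx f) := (smooth_pd (v := (1, 0)) hf).continuous
  have hi := integrable_of_continuous hc
  rw [area_eq_prod] at hi ⊢
  rw [integral_prod_symm _ hi]
  refine setIntegral_eq_zero_of_forall_eq_zero fun y hy => ?_
  rw [integral_Icc_eq_integral_Ioc,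
    ← intervalIntegral.integral_of_le (by positivity),
    intervalIntegral.integral_eq_sub_of_hasDerivAt (f := fun x => f (x, y)), hb y hy, sub_self]
  · intro x _
    have h1 : HasFDerivAt f (fderiv ℝ f (x, y)) (x, y) :=
      (hf.differentiable (by simp) _).hasFDerivAt
    have h2 : HasDerivAt (fun x : ℝ => (x, y)) (1, 0) x :=
      (hasDerivAt_id x).prodMk (hasDerivAt_const x y)
    exact h1.comp_hasDerivAt x h2
  · exact Continuous.intervalIntegrable (hc.comp (by fun_prop)) _ _

lemma integral_dy_eq_zero {f : ℝ × ℝ → ℝ} (hf : ContDiff ℝ ∞ f)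
    (hb : ∀ x ∈ Set.Icc 0 (2 * Real.pi), f (x, 0) = f (x, 2 * Real.pi)) :
    ∫ p, dy f p ∂area = 0 := by
  have hc : Continuous (dy f) := (smooth_pd (v := (0, 1)) hf).continuous
  have hi := integrable_of_continuous hc
  rw [area_eq_prod] at hi ⊢
  rw [integral_prod _ hi]
  refine setIntegral_eq_zero_of_forall_eq_zero fun x hx => ?_
  rw [integral_Icc_eq_integral_Ioc,
    ← intervalIntegral.integral_of_le (by positivity),
    intervalIntegral.integral_eq_sub_of_hasDerivAt (f := fun y => f (x, y)), hb x hx, sub_self]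
  · intro y _
    have h1 : HasFDerivAt f (fderiv ℝ f (x, y)) (x, y) :=
      (hf.differentiable (by simp) _).hasFDerivAt
    have h2 : HasDerivAt (fun y : ℝ => (x, y)) (0, 1) y :=
      (hasDerivAt_const y x).prodMk (hasDerivAt_id y)
    exact h1.comp_hasDerivAt y h2
  · exact Continuous.intervalIntegrable (hc.comp (by fun_prop)) _ _

/-- A direction in which derivatives of periodic functions integrate to zero. Both coordinate
directions qualify, so arguments for `dx` and `dy` can be given once. -/
def IsPerDir (v : ℝ × ℝ) : Prop := ∀ f, Per f → ∫ p, pd v f p ∂area = 0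

lemma isPerDir_x : IsPerDir (1, 0) := fun f hf =>
  integral_dx_eq_zero hf.smooth fun y _ => by simpa using (hf.per_x (0, y)).symm

lemma isPerDir_y : IsPerDir (0, 1) := fun f hf =>
  integral_dy_eq_zero hf.smooth fun x _ => by simpa using (hf.per_y (x, 0)).symm

section ip
variable {f g h : ℝ × ℝ → ℝ}

lemma ip_comm (f g : ℝ × ℝ → ℝ) : ip f g = ip g f := by
  simp only [ip, mul_comm]

lemma ip_add_left (hf : MemLp f 2 area) (hg : MemLp g 2 area) (hh : MemLp h 2 area) :
    ip (f + g) h = ip f h + ip g h := by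
  rw [ip, ip, ip, ← integral_add (memLp_integrable_mul hf hh) (memLp_integrable_mul hg hh)]
  exact integral_congr_ae (.of_forall fun p => by simp only [Pi.add_apply]; ring)

lemma ip_sub_left (hf : MemLp f 2 area) (hg : MemLp g 2 area) (hh : MemLp h 2 area) :
    ip (f - g) h = ip f h - ip g h := by
  rw [ip, ip, ip, ← integral_sub (memLp_integrable_mul hf hh) (memLp_integrable_mul hg hh)]
  exact integral_congr_ae (.of_forall fun p => by simp only [Pi.sub_apply]; ring)

lemma ip_smul_left (c : ℝ) (f g : ℝ × ℝ → ℝ) : ip (c • f) g = c * ip f g := by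
  rw [ip, ip, ← integral_const_mul]
  exact integral_congr_ae (.of_forall fun p => by simp only [Pi.smul_apply, smul_eq_mul]; ring)

lemma ip_add_right (hf : MemLp f 2 area) (hg : MemLp g 2 area) (hh : MemLp h 2 area) :
    ip f (g + h) = ip f g + ip f h := by
  rw [ip_comm, ip_add_left hg hh hf, ip_comm g, ip_comm h]

lemma ip_smul_right (c : ℝ) (f g : ℝ × ℝ → ℝ) : ip f (c • g) = c * ip f g := by
  rw [ip_comm, ip_smul_left, ip_comm]

lemma ip_self_nonneg (f : ℝ × ℝ → ℝ) : 0 ≤ ip f f :=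
  integral_nonneg fun p => mul_self_nonneg (f p)

/-- The Cauchy–Schwarz inequality. -/
lemma ip_sq_le (hf : MemLp f 2 area) (hg : MemLp g 2 area) :
    ip f g ^ 2 ≤ ip f f * ip g g := by
  -- The quadratic polynomial `t ↦ ‖f + t g‖²` is nonnegative, so its discriminant is not positive.
  have key : ∀ t : ℝ, 0 ≤ ip g g * (t * t) + 2 * ip f g * t + ip f f := by
    intro t
    have h1 : MemLp (t • g) 2 area := hg.const_smul t
    have h := ip_self_nonneg (f + t • g)
    rw [ip_add_left hf h1 (hf.add h1), ip_add_right hf hf h1, ip_add_right h1 hf h1] at h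
    simp only [ip_smul_left, ip_smul_right] at h
    rw [ip_comm g f] at h
    linarith
  have := discrim_le_zero key
  rw [discrim] at this
  nlinarith

lemma ip_mono (hf : Continuous f) (hg : Continuous g) {f' g' : ℝ × ℝ → ℝ} (hf' : Continuous f')
    (hg' : Continuous g') (hle : ∀ p ∈ square, f p * g p ≤ f' p * g' p) : ip f g ≤ ip f' g' :=
  setIntegral_mono_on (integrable_of_continuous (hf.mul hg))
    (integrable_of_continuous (hf'.mul hg'))
    measurableSet_square hle

lemma ip_pd_left {v : ℝ × ℝ} (hv : IsPerDir v) (hf : Per f) (hg : Per g) :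
    ip (pd v f) g = -ip f (pd v g) := by
  have h := hv _ (hf.mul hg)
  rw [pd_mul hf.smooth hg.smooth] at h
  rw [integral_add' (integrable_of_continuous ((hf.pd v).continuous.mul hg.continuous))
    (integrable_of_continuous (hf.continuous.mul (hg.pd v).continuous))] at h
  simp only [Pi.mul_apply] at h
  simp only [ip]
  linarith

end ip

/-! ### Interpolation inequalities -/

section interpolation
variable {a b : ℝ × ℝ → ℝ}

/-- The squared norm of the gradient. -/
noncomputable def gradSq (a : ℝ × ℝ → ℝ) : ℝ := ip (dx a) (dx a) + ip (dy a) (dy a)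

lemma gradSq_nonneg (a : ℝ × ℝ → ℝ) : 0 ≤ gradSq a :=
  add_nonneg (ip_self_nonneg _) (ip_self_nonneg _)

lemma ip_lap_right (ha : Per a) (hb : Per b) :
    ip a (lap b) = -(ip (dx a) (dx b) + ip (dy a) (dy b)) := by
  have h1 := ip_pd_left isPerDir_x ha hb.dx
  have h2 := ip_pd_left isPerDir_y ha hb.dy
  have h : lap b = dx (dx b) + dy (dy b) := rfl
  rw [h, ip_add_right (memLp_of_continuous ha.continuous)
    (memLp_of_continuous hb.dx.dx.continuous) (memLp_of_continuous hb.dy.dy.continuous)]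
  simp only [dx_eq_pd, dy_eq_pd] at h1 h2 ⊢
  linarith

lemma ip_lap_comm (ha : Per a) (hb : Per b) : ip a (lap b) = ip (lap a) b := by
  rw [ip_comm (lap a), ip_lap_right ha hb, ip_lap_right hb ha, ip_comm (dx a), ip_comm (dy a)]

lemma gradSq_sq_le (ha : Per a) : gradSq a ^ 2 ≤ ip a a * ip (lap a) (lap a) := by
  have h := ip_sq_le (memLp_of_continuous ha.continuous) (memLp_of_continuous ha.lap.continuous)
  rw [ip_lap_right ha ha, neg_sq] at h
  exact h

/-- The `L²` norm of the Laplacian controls all second derivatives. -/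
lemma ip_lap_lap (ha : Per a) : ip (lap a) (lap a) = ip (dx (dx a)) (dx (dx a))
    + ip (dy (dy a)) (dy (dy a)) + 2 * ip (dy (dx a)) (dy (dx a)) := by
  have hx := memLp_of_continuous ha.dx.dx.continuous
  have hy := memLp_of_continuous ha.dy.dy.continuous
  have hcomm : ∀ f, Per f → dx (dy f) = dy (dx f) := fun f hf => pd_comm hf.smooth _ _
  have hmix : ip (dx (dx a)) (dy (dy a)) = ip (dy (dx a)) (dy (dx a)) := by
    have h1 : ip (dx (dx a)) (dy (dy a)) = -ip (dx a) (dx (dy (dy a))) :=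
      ip_pd_left isPerDir_x ha.dx ha.dy.dy
    have h2 : ip (dy (dx a)) (dy (dx a)) = -ip (dx a) (dy (dy (dx a))) :=
      ip_pd_left isPerDir_y ha.dx ha.dx.dy
    rw [h1, h2, hcomm _ ha.dy, hcomm _ ha]
  have h : lap a = dx (dx a) + dy (dy a) := rfl
  rw [h, ip_add_left hx hy (hx.add hy), ip_add_right hx hx hy, ip_add_right hy hx hy,
    ip_comm (dy (dy a)) (dx (dx a)), hmix]
  ring

lemma abs_le_integral_abs_deriv {f f' : ℝ → ℝ} (hf : ∀ x, HasDerivAt f (f' x) x)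
    (hc : Continuous f') (h0 : f 0 = 0) {x : ℝ} (hx : x ∈ Set.Icc 0 (2 * Real.pi)) :
    |f x| ≤ ∫ t in Set.Icc 0 (2 * Real.pi), |f' t| := by
  have h1 : ∫ t in (0 : ℝ)..x, f' t = f x - f 0 :=
    intervalIntegral.integral_eq_sub_of_hasDerivAt (fun t _ => hf t) (hc.intervalIntegrable _ _)
  rw [h0, sub_zero] at h1
  rw [← h1, intervalIntegral.integral_of_le hx.1]
  refine (abs_integral_le_integral_abs).trans ?_
  refine setIntegral_mono_set (hc.abs.continuousOn.integrableOn_compact isCompact_Icc)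
    (.of_forall fun _ => abs_nonneg _) (.of_forall fun t ht => ⟨ht.1.le, ht.2.trans hx.2⟩)

lemma abs_le_integral_mixed {f : ℝ × ℝ → ℝ} (hf : ContDiff ℝ ∞ f) (h0 : ∀ y, f (0, y) = 0)
    (h1 : ∀ x, dx f (x, 0) = 0) {p : ℝ × ℝ} (hp : p ∈ square) :
    |f p| ≤ ∫ q, |dy (dx f) q| ∂area := by
  have hs1 : ContDiff ℝ ∞ (dx f) := smooth_pd (v := (1, 0)) hf
  have hs2 : ContDiff ℝ ∞ (dy (dx f)) := smooth_pd (v := (0, 1)) hs1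
  have hi : Integrable (fun q => |dy (dx f) q|) area :=
    integrable_of_continuous hs2.continuous.abs
  have hx : |f p| ≤ ∫ s in Set.Icc 0 (2 * Real.pi), |dx f (s, p.2)| := by
    refine abs_le_integral_abs_deriv (f := fun s => f (s, p.2)) (fun s => ?_)
      (hs1.continuous.comp (by fun_prop)) (h0 _) hp.1
    exact (hf.differentiable (by simp) _).hasFDerivAt.comp_hasDerivAt s
      ((hasDerivAt_id s).prodMk (hasDerivAt_const s p.2))
  have hy : ∀ s, |dx f (s, p.2)| ≤ ∫ t in Set.Icc 0 (2 * Real.pi), |dy (dx f) (s, t)| := by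
    intro s
    refine abs_le_integral_abs_deriv (f := fun t => dx f (s, t)) (fun t => ?_)
      (hs2.continuous.comp (by fun_prop)) (h1 _) hp.2
    exact (hs1.differentiable (by simp) _).hasFDerivAt.comp_hasDerivAt t
      ((hasDerivAt_const t s).prodMk (hasDerivAt_id t))
  rw [area_eq_prod] at hi ⊢
  rw [integral_prod _ hi]
  refine hx.trans (integral_mono ?_ hi.integral_prod_left hy)
  exact (Continuous.continuousOn (hs1.continuous.comp (by fun_prop)).abs).integrableOn_compact
    isCompact_Icc

/-- Agmon's inequality `‖a‖_∞² ≲ ‖a‖ ‖Δa‖`, for functions that vanish on two sides of the square: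
`a²` at a point is the integral of its mixed derivative `2 (a_x a_y + a a_xy)` over a rectangle. -/
lemma pow_four_le (ha : Per a) (hl : ∀ y, a (0, y) = 0) (hb : ∀ x, a (x, 0) = 0) {p : ℝ × ℝ}
    (hp : p ∈ square) : (a p ^ 2) ^ 2 ≤ 6 * (ip a a * ip (lap a) (lap a)) := by
  have hdx : dx (a * a) = dx a * a + a * dx a := pd_mul ha.smooth ha.smooth
  have hmix : dy (dx (a * a)) = (2 : ℝ) • (dx a * dy a) + (2 : ℝ) • (a * dy (dx a)) := by
    rw [hdx]
    have h1 : dy (dx a * a + a * dx a) = dy (dx a * a) + dy (a * dx a) :=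
      pd_add (ha.dx.mul ha).smooth (ha.mul ha.dx).smooth
    have h2 : dy (dx a * a) = dy (dx a) * a + dx a * dy a := pd_mul ha.dx.smooth ha.smooth
    have h3 : dy (a * dx a) = dy a * dx a + a * dy (dx a) := pd_mul ha.smooth ha.dx.smooth
    rw [h1, h2, h3]
    ext q
    simp only [Pi.add_apply, Pi.mul_apply, Pi.smul_apply, smul_eq_mul]
    ring
  have hmain : a p ^ 2 ≤ ∫ q, |dy (dx (a * a)) q| ∂area := by
    have := abs_le_integral_mixed (ha.mul ha).smooth (fun y => by simp [hl])
      (fun x => by simp [hdx, hb]) hp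
    simpa [← sq] using this
  set abs' : (ℝ × ℝ → ℝ) → ℝ × ℝ → ℝ := fun f q => |f q|
  have hself : ∀ f, ip (abs' f) (abs' f) = ip f f := fun f => by simp [ip, abs']
  have hcs : ∀ f g, Continuous f → Continuous g →
      ip (abs' f) (abs' g) ^ 2 ≤ ip f f * ip g g := fun f g hf hg => by
    have := ip_sq_le (memLp_of_continuous hf.abs) (memLp_of_continuous hg.abs)
    rwa [show ip (fun q => |f q|) (fun q => |f q|) = ip f f from hself f,
      show ip (fun q => |g q|) (fun q => |g q|) = ip g g from hself g] at this
  have hsplit : ∫ q, |dy (dx (a * a)) q| ∂area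
      ≤ 2 * ip (abs' (dx a)) (abs' (dy a)) + 2 * ip (abs' a) (abs' (dy (dx a))) := by
    have c1 : Continuous fun q => |dx a q| * |dy a q| :=
      ha.dx.continuous.abs.mul ha.dy.continuous.abs
    have c2 : Continuous fun q => |a q| * |dy (dx a) q| :=
      ha.continuous.abs.mul ha.dx.dy.continuous.abs
    simp only [ip, abs']
    rw [← integral_const_mul, ← integral_const_mul, ← integral_add
      (integrable_of_continuous (c1.const_mul 2)) (integrable_of_continuous (c2.const_mul 2))]
    refine integral_mono (integrable_of_continuous (ha.mul ha).dx.dy.continuous.abs)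
      (integrable_of_continuous ((c1.const_mul 2).add (c2.const_mul 2))) fun q => ?_
    simp only [hmix, Pi.add_apply, Pi.mul_apply, Pi.smul_apply, smul_eq_mul]
    refine (abs_add_le _ _).trans (le_of_eq ?_)
    simp [abs_mul]
  have h1 := hcs (dx a) (dy a) ha.dx.continuous ha.dy.continuous
  have h2 := hcs a (dy (dx a)) ha.continuous ha.dx.dy.continuous
  have hg := gradSq_sq_le ha
  rw [gradSq] at hg
  have hY := ip_lap_lap ha
  have n1 := ip_self_nonneg (dx (dx a))
  have n2 := ip_self_nonneg (dy (dy a))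
  have n3 : ip a a * (2 * ip (dy (dx a)) (dy (dx a))) ≤ ip a a * ip (lap a) (lap a) :=
    mul_le_mul_of_nonneg_left (by linarith) (ip_self_nonneg a)
  have hle := hmain.trans hsplit
  have := pow_le_pow_left₀ (sq_nonneg (a p)) hle 2
  nlinarith [sq_nonneg (ip (abs' (dx a)) (abs' (dy a)) - ip (abs' a) (abs' (dy (dx a)))),
    sq_nonneg (ip (dx a) (dx a) - ip (dy a) (dy a))]

/-- The Gagliardo–Nirenberg inequality `‖a_v‖₄² ≤ 3 ‖a‖_∞ ‖a_vv‖`: integrate `a_v · a_v³` by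
parts. -/
lemma quartic_le {v : ℝ × ℝ} (hv : IsPerDir v) (ha : Per a) {m : ℝ}
    (hm : ∀ p ∈ square, a p ^ 2 ≤ m) :
    ip (pd v a * pd v a) (pd v a * pd v a) ≤ 9 * m * ip (pd v (pd v a)) (pd v (pd v a)) := by
  have hc := ha.pd v
  have hc' := hc.pd v
  set c := pd v a
  set X := ip (c * c) (c * c)
  have hX : X = -3 * ip (c * c) (a * pd v c) := by
    have h1 : X = ip c (c * (c * c)) := by
      simp only [X, ip, Pi.mul_apply]
      exact integral_congr_ae (.of_forall fun p => by ring)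
    have h3 : pd v (c * (c * c)) = (3 : ℝ) • (c * c * pd v c) := by
      rw [pd_mul hc.smooth (hc.mul hc).smooth, pd_mul hc.smooth hc.smooth]
      ext p
      simp only [Pi.add_apply, Pi.mul_apply, Pi.smul_apply, smul_eq_mul]
      ring
    rw [h1, ip_pd_left hv ha (hc.mul (hc.mul hc)), h3, ip_smul_right]
    have : ip a (c * c * pd v c) = ip (c * c) (a * pd v c) := by
      simp only [ip, Pi.mul_apply]
      exact integral_congr_ae (.of_forall fun p => by ring)
    rw [this]; ring
  have hcs := ip_sq_le (memLp_of_continuous (hc.mul hc).continuous)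
    (memLp_of_continuous (ha.mul hc').continuous)
  have hm2 : ip (a * pd v c) (a * pd v c) ≤ m * ip (pd v c) (pd v c) := by
    rw [← ip_smul_left]
    refine ip_mono (ha.mul hc').continuous (ha.mul hc').continuous
      (hc'.const_smul m).continuous hc'.continuous fun p hp => ?_
    simp only [Pi.mul_apply, Pi.smul_apply, smul_eq_mul]
    nlinarith [mul_le_mul_of_nonneg_right (hm p hp) (mul_self_nonneg (pd v c p))]
  have hXn : 0 ≤ X := ip_self_nonneg _
  have h0 : (0 : ℝ × ℝ) ∈ square := ⟨⟨le_rfl, by positivity⟩, ⟨le_rfl, by positivity⟩⟩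
  have hm0 : 0 ≤ m := (sq_nonneg _).trans (hm 0 h0)
  have hn := ip_self_nonneg (pd v c)
  rcases hXn.eq_or_lt with h | h
  · rw [← h]; positivity
  · refine le_of_mul_le_mul_left ?_ h
    have := mul_le_mul_of_nonneg_left hm2 hXn
    nlinarith [congrArg (· ^ 2) hX]

/-- The squared Euclidean length of the gradient, as a function. -/
noncomputable def gradLen (a : ℝ × ℝ → ℝ) : ℝ × ℝ → ℝ := dx a * dx a + dy a * dy a

lemma Per.gradLen (ha : Per a) : Per (gradLen a) := (ha.dx.mul ha.dx).add (ha.dy.mul ha.dy)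

lemma ip_gradLen_le (ha : Per a) {m : ℝ} (hm : ∀ p ∈ square, a p ^ 2 ≤ m) :
    ip (gradLen a) (gradLen a) ≤ 18 * m * ip (lap a) (lap a) := by
  have hx := quartic_le isPerDir_x ha hm
  have hy := quartic_le isPerDir_y ha hm
  simp only [← dx_eq_pd, ← dy_eq_pd] at hx hy
  have cx := memLp_of_continuous (ha.dx.mul ha.dx).continuous
  have cy := memLp_of_continuous (ha.dy.mul ha.dy).continuous
  have h0 : (0 : ℝ × ℝ) ∈ square := ⟨⟨le_rfl, by positivity⟩, ⟨le_rfl, by positivity⟩⟩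
  have hm0 : 0 ≤ m := (sq_nonneg _).trans (hm 0 h0)
  have h := ip_self_nonneg (dx a * dx a - dy a * dy a)
  rw [ip_sub_left cx cy (cx.sub cy), ip_comm (dx a * dx a), ip_comm (dy a * dy a),
    ip_sub_left cx cy cx, ip_sub_left cx cy cy, ip_comm (dy a * dy a) (dx a * dx a)] at h
  have e : ip (gradLen a) (gradLen a) = ip (dx a * dx a) (dx a * dx a)
      + ip (dy a * dy a) (dy a * dy a) + 2 * ip (dx a * dx a) (dy a * dy a) := by
    rw [gradLen, ip_add_left cx cy (cx.add cy), ip_add_right cx cx cy, ip_add_right cy cx cy,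
      ip_comm (dy a * dy a) (dx a * dx a)]
    ring
  have hY := ip_lap_lap ha
  have hn := mul_nonneg hm0 (ip_self_nonneg (dy (dx a)))
  rw [hY, e]
  nlinarith

/-- A Poincaré inequality for semi-implicit time stepping: `‖b‖²` is controlled by
`a |∇b|` and `‖∇b‖ ‖b - a‖`, where `a` may differ from `b`.
It comes from `‖b‖² = -2 ∫ (x - π) b b_x`. -/
lemma ip_self_sq_le (ha : Per a) (hb : Per b) (hl : ∀ y, b (0, y) = 0) :
    ip b b ^ 2 ≤ 32 * Real.pi ^ 4 * ip (a * gradLen b) a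
      + 8 * Real.pi ^ 2 * (gradSq b * ip (b - a) (b - a)) := by
  set w : ℝ × ℝ → ℝ := fun p => p.1 - Real.pi with hw
  have hws : ContDiff ℝ ∞ w := by fun_prop
  have hwc := hws.continuous
  have hwx : dx w = fun _ => 1 := by
    ext p
    have : HasFDerivAt w (ContinuousLinearMap.fst ℝ ℝ ℝ) p := by
      simpa [hw] using (hasFDerivAt_fst (𝕜 := ℝ) (p := p)).sub_const Real.pi
    simp [dx, this.fderiv]
  have hzero : ∫ p, dx (w * (b * b)) p ∂area = 0 := by
    refine integral_dx_eq_zero (hws.mul (hb.mul hb).smooth) fun y _ => ?_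
    have h2 : b (2 * Real.pi, y) = 0 := by
      have := hb.per_x (0, y)
      simpa [hl] using this
    simp [hl, h2]
  have hd : dx (w * (b * b)) = dx w * (b * b) + w * (dx b * b + b * dx b) := by
    have h1 : dx (w * (b * b)) = dx w * (b * b) + w * dx (b * b) :=
      pd_mul hws (hb.mul hb).smooth
    have h2 : dx (b * b) = dx b * b + b * dx b := pd_mul hb.smooth hb.smooth
    rw [h1, h2]
  have key : ip b b = -2 * (ip w (a * dx b) + ip (w * dx b) (b - a)) := by
    have hc1 := ha.continuous
    have hc2 := hb.continuous
    have hc3 := hb.dx.continuous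
    have e : ∀ p, dx (w * (b * b)) p
        = b p * b p + 2 * (w p * (a * dx b) p + (w * dx b) p * (b - a) p) := by
      intro p
      simp only [hd, hwx, Pi.add_apply, Pi.mul_apply, Pi.sub_apply]
      ring
    simp only [e] at hzero
    rw [integral_add (integrable_of_continuous (by fun_prop))
      (integrable_of_continuous (by fun_prop)), integral_const_mul,
      integral_add (integrable_of_continuous (by fun_prop))
      (integrable_of_continuous (by fun_prop))] at hzero
    simp only [ip]
    linarith
  have hwb : ∀ p ∈ square, w p ^ 2 ≤ Real.pi ^ 2 := fun p hp => by
    have h1 := hp.1.1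
    have h2 := hp.1.2
    simp only [hw]
    nlinarith
  have hvol : area.real Set.univ = 4 * Real.pi ^ 2 := by
    rw [area_eq_prod, ← Set.univ_prod_univ, measureReal_prod_prod]
    simp [Real.volume_real_Icc, Real.pi_pos.le]
    ring
  have b1 : ip w w ≤ 4 * Real.pi ^ 4 := by
    have h := ip_mono hwc hwc (f' := fun _ => Real.pi) (g' := fun _ => Real.pi)
      continuous_const continuous_const fun p hp => by nlinarith [hwb p hp]
    refine h.trans (le_of_eq ?_)
    simp only [ip, integral_const, hvol, smul_eq_mul]
    ring
  have b2 : ip (a * dx b) (a * dx b) ≤ ip (a * gradLen b) a := by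
    refine ip_mono (ha.mul hb.dx).continuous (ha.mul hb.dx).continuous
      (ha.mul hb.gradLen).continuous ha.continuous fun p _ => ?_
    simp only [gradLen, Pi.add_apply, Pi.mul_apply]
    nlinarith [sq_nonneg (a p * dy b p)]
  have b3 : ip (w * dx b) (w * dx b) ≤ Real.pi ^ 2 * gradSq b := by
    have h : ip (w * dx b) (w * dx b) ≤ ip (Real.pi ^ 2 • dx b) (dx b) := by
      refine ip_mono (hwc.mul hb.dx.continuous) (hwc.mul hb.dx.continuous)
        (hb.dx.const_smul _).continuous hb.dx.continuous fun p hp => ?_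
      simp only [Pi.mul_apply, Pi.smul_apply, smul_eq_mul]
      nlinarith [mul_le_mul_of_nonneg_right (hwb p hp) (mul_self_nonneg (dx b p))]
    rw [ip_smul_left] at h
    refine h.trans (mul_le_mul_of_nonneg_left ?_ (by positivity))
    rw [gradSq]
    linarith [ip_self_nonneg (dy b)]
  have c1 := ip_sq_le (memLp_of_continuous hwc) (memLp_of_continuous (ha.mul hb.dx).continuous)
  have c2 := ip_sq_le (memLp_of_continuous (hwc.mul hb.dx.continuous))
    (memLp_of_continuous (hb.sub ha).continuous)
  have d1 := c1.trans (mul_le_mul b1 b2 (ip_self_nonneg _) (by positivity))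
  have d2 := c2.trans (mul_le_mul_of_nonneg_right b3 (ip_self_nonneg _))
  rw [key]
  nlinarith [sq_nonneg (ip w (a * dx b) - ip (w * dx b) (b - a))]

end interpolation

/-! ### The spectral space -/

section specSpace
variable {m : ℕ} {u : ℝ × ℝ → ℝ}

lemma sinMode_smooth (k l : ℕ) : ContDiff ℝ ∞ (sinMode k l) := by
  unfold sinMode
  fun_prop

lemma per_sinMode (k l : ℕ) : Per (sinMode k l) := by
  refine ⟨sinMode_smooth k l, fun p => ?_, fun p => ?_⟩
  · have : (k : ℝ) * (p.1 + 2 * Real.pi) = k * p.1 + k * (2 * Real.pi) := by ring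
    simp [sinMode, this, Real.sin_add_nat_mul_two_pi]
  · have : (l : ℝ) * (p.2 + 2 * Real.pi) = l * p.2 + l * (2 * Real.pi) := by ring
    simp [sinMode, this, Real.sin_add_nat_mul_two_pi]

lemma partials_mul {A B : ℝ → ℝ} {A' B' : ℝ} {p : ℝ × ℝ} (hA : HasDerivAt A A' p.1)
    (hB : HasDerivAt B B' p.2) :
    dx (fun q => A q.1 * B q.2) p = A' * B p.2 ∧ dy (fun q => A q.1 * B q.2) p = A p.1 * B' := by
  have h1 := hA.comp_hasFDerivAt p (hasFDerivAt_fst (𝕜 := ℝ) (p := p))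
  have h2 := hB.comp_hasFDerivAt p (hasFDerivAt_snd (𝕜 := ℝ) (p := p))
  have h := (h1.mul h2).fderiv
  have e : (fun q : ℝ × ℝ => A q.1 * B q.2) = (A ∘ Prod.fst) * (B ∘ Prod.snd) := rfl
  constructor
  · rw [dx, e, h]; simp; ring
  · rw [dy, e, h]; simp

lemma hasDerivAt_sin_mul (k x : ℝ) :
    HasDerivAt (fun x => Real.sin (k * x)) (k * Real.cos (k * x)) x := by
  have := ((hasDerivAt_id x).const_mul k).sin
  simpa [mul_comm] using this

lemma hasDerivAt_cos_mul (k x : ℝ) :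
    HasDerivAt (fun x => k * Real.cos (k * x)) (-k ^ 2 * Real.sin (k * x)) x := by
  have := (((hasDerivAt_id' x).const_mul k).cos).const_mul k
  exact this.congr_deriv (by ring)

lemma dx_sinMode (k l : ℕ) :
    dx (sinMode k l) = fun p => (k * Real.cos (k * p.1)) * Real.sin (l * p.2) :=
  funext fun p => (partials_mul (hasDerivAt_sin_mul k p.1) (hasDerivAt_sin_mul l p.2)).1

lemma dy_sinMode (k l : ℕ) :
    dy (sinMode k l) = fun p => Real.sin (k * p.1) * (l * Real.cos (l * p.2)) :=
  funext fun p => (partials_mul (hasDerivAt_sin_mul k p.1) (hasDerivAt_sin_mul l p.2)).2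

lemma lap_sinMode (k l : ℕ) : lap (sinMode k l) = (-((k : ℝ) ^ 2 + l ^ 2)) • sinMode k l := by
  ext p
  have h1 := (partials_mul (hasDerivAt_cos_mul k p.1) (hasDerivAt_sin_mul l p.2)).1
  have h2 := (partials_mul (hasDerivAt_sin_mul k p.1) (hasDerivAt_cos_mul l p.2)).2
  rw [lap, dx_sinMode, dy_sinMode, h1, h2]
  simp only [Pi.smul_apply, sinMode, smul_eq_mul]
  ring

lemma per_of_mem_specSpace (hu : u ∈ specSpace m) : Per u := by
  induction hu using Submodule.span_induction with
  | mem f hf => obtain ⟨k, -, l, -, rfl⟩ := hf; exact per_sinMode k l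
  | zero => exact Per.const 0
  | add f g _ _ hf hg => exact hf.add hg
  | smul c f _ hf => exact hf.const_smul c

lemma eq_zero_of_mem_specSpace (hu : u ∈ specSpace m) :
    (∀ y, u (0, y) = 0) ∧ ∀ x, u (x, 0) = 0 := by
  induction hu using Submodule.span_induction with
  | mem f hf => obtain ⟨k, -, l, -, rfl⟩ := hf; simp [sinMode]
  | zero => simp
  | add f g _ _ hf hg => simp [hf, hg]
  | smul c f _ hf => simp [hf]

lemma lap_add {f g : ℝ × ℝ → ℝ} (hf : Per f) (hg : Per g) : lap (f + g) = lap f + lap g := by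
  have e : ∀ f, lap f = pd (1, 0) (pd (1, 0) f) + pd (0, 1) (pd (0, 1) f) := fun _ => rfl
  rw [e, e, e, pd_add hf.smooth hg.smooth, pd_add hf.smooth hg.smooth,
    pd_add (hf.pd _).smooth (hg.pd _).smooth, pd_add (hf.pd _).smooth (hg.pd _).smooth]
  abel

lemma lap_smul (c : ℝ) {f : ℝ × ℝ → ℝ} (hf : Per f) : lap (c • f) = c • lap f := by
  have e : ∀ f, lap f = pd (1, 0) (pd (1, 0) f) + pd (0, 1) (pd (0, 1) f) := fun _ => rfl
  rw [e, e, pd_smul _ hf.smooth, pd_smul _ hf.smooth, pd_smul _ (hf.pd _).smooth,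
    pd_smul _ (hf.pd _).smooth, smul_add]

lemma lap_mem_specSpace (hu : u ∈ specSpace m) : lap u ∈ specSpace m := by
  induction hu using Submodule.span_induction with
  | mem f hf =>
    have hf' := hf
    obtain ⟨k, -, l, -, rfl⟩ := hf
    rw [lap_sinMode]
    exact Submodule.smul_mem _ _ (Submodule.subset_span hf')
  | zero =>
    have : lap (0 : ℝ × ℝ → ℝ) = 0 := by simpa using lap_smul 0 (Per.const 0)
    rw [this]
    exact Submodule.zero_mem _
  | add f g hf' hg' hf hg =>
    rw [lap_add (per_of_mem_specSpace hf') (per_of_mem_specSpace hg')]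
    exact Submodule.add_mem _ hf hg
  | smul c f hf' hf =>
    rw [lap_smul _ (per_of_mem_specSpace hf')]
    exact Submodule.smul_mem _ _ hf

end specSpace

/-! ### Weak derivatives against sine modes -/

/-- A smooth cut-off that vanishes within `1 / n` of the ends of `[0, 2π]` and equals `1` at
distance `2 / n` from them. -/
noncomputable def cutoff (n : ℝ) (x : ℝ) : ℝ :=
  Real.smoothTransition (n * x - 1) * Real.smoothTransition (n * (2 * Real.pi - x) - 1)

/-- The sine `sin (k x)`, cut off near the ends of `[0, 2π]`. -/
noncomputable def cutSin (n k : ℝ) (x : ℝ) : ℝ := cutoff n x * Real.sin (k * x)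

lemma cutoff_smooth (n : ℝ) : ContDiff ℝ ∞ (cutoff n) := by
  unfold cutoff
  exact (Real.smoothTransition.contDiff.comp (by fun_prop)).mul
    (Real.smoothTransition.contDiff.comp (by fun_prop))

lemma cutSin_smooth (n k : ℝ) : ContDiff ℝ ∞ (cutSin n k) :=
  (cutoff_smooth n).mul (by fun_prop)

lemma cutoff_mem_Icc (n x : ℝ) : cutoff n x ∈ Set.Icc 0 1 :=
  ⟨mul_nonneg (Real.smoothTransition.nonneg _) (Real.smoothTransition.nonneg _),
    mul_le_one₀ (Real.smoothTransition.le_one _) (Real.smoothTransition.nonneg _)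
      (Real.smoothTransition.le_one _)⟩

lemma cutSin_support {n : ℝ} (hn : 0 < n) (k : ℝ) :
    Function.support (cutSin n k) ⊆ Set.Icc (1 / n) (2 * Real.pi - 1 / n) := by
  intro x hx
  by_contra h
  refine hx ?_
  have h' : n * x - 1 ≤ 0 ∨ n * (2 * Real.pi - x) - 1 ≤ 0 := by
    by_contra! h2
    refine h ⟨?_, ?_⟩
    · rw [div_le_iff₀ hn]; linarith
    · have : 1 / n ≤ 2 * Real.pi - x := by rw [div_le_iff₀ hn]; linarith
      linarith
  rcases h' with h' | h' <;>
    simp [cutSin, cutoff, Real.smoothTransition.zero_of_nonpos h']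

lemma cutoff_eventuallyEq_one {x : ℝ} (hx : x ∈ Set.Ioo 0 (2 * Real.pi)) :
    ∀ᶠ n : ℕ in atTop, cutoff (n + 1) =ᶠ[𝓝 x] fun _ => 1 := by
  have h0 : Tendsto (fun n : ℕ => (n : ℝ) + 1) atTop atTop :=
    tendsto_atTop_add_const_right _ _ tendsto_natCast_atTop_atTop
  have h1 := (h0.atTop_mul_const hx.1).eventually_gt_atTop 2
  have h2 := (h0.atTop_mul_const (sub_pos.2 hx.2)).eventually_gt_atTop 2
  filter_upwards [h1, h2] with n h1 h2
  have e1 : ∀ᶠ y in 𝓝 x, 2 < ((n : ℝ) + 1) * y :=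
    (by fun_prop : ContinuousAt (fun y => ((n : ℝ) + 1) * y) x).eventually_const_lt h1
  have e2 : ∀ᶠ y in 𝓝 x, 2 < ((n : ℝ) + 1) * (2 * Real.pi - y) :=
    (by fun_prop : ContinuousAt (fun y => ((n : ℝ) + 1) * (2 * Real.pi - y)) x).eventually_const_lt
      h2
  filter_upwards [e1, e2] with y h1 h2
  simp [cutoff,
    Real.smoothTransition.one_of_one_le (show (1 : ℝ) ≤ ((n : ℝ) + 1) * y - 1 by linarith),
    Real.smoothTransition.one_of_one_le
      (show (1 : ℝ) ≤ ((n : ℝ) + 1) * (2 * Real.pi - y) - 1 by linarith)]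

lemma deriv_smoothTransition_eq_zero {t : ℝ} (ht : t < 0 ∨ 1 < t) :
    deriv Real.smoothTransition t = 0 := by
  rcases ht with ht | ht
  · have : Real.smoothTransition =ᶠ[𝓝 t] fun _ => 0 := by
      filter_upwards [eventually_lt_nhds ht] with s hs
      exact Real.smoothTransition.zero_of_nonpos hs.le
    rw [this.deriv_eq, deriv_const]
  · have : Real.smoothTransition =ᶠ[𝓝 t] fun _ => 1 := by
      filter_upwards [eventually_gt_nhds ht] with s hs
      exact Real.smoothTransition.one_of_one_le hs.le
    rw [this.deriv_eq, deriv_const]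

lemma exists_mul_deriv_smoothTransition_le :
    ∃ C, ∀ t, |t| * |deriv Real.smoothTransition (t - 1)| ≤ C := by
  have hc : Continuous (deriv Real.smoothTransition) :=
    (Real.smoothTransition.contDiff (n := ⊤)).continuous_deriv (by simp)
  obtain ⟨C, hC⟩ := (isCompact_Icc (a := (0 : ℝ)) (b := 1)).exists_bound_of_continuousOn
    hc.continuousOn
  have hC0 : 0 ≤ C := (norm_nonneg _).trans (hC 0 (by simp))
  refine ⟨2 * C, fun t => ?_⟩
  by_cases ht : t - 1 ∈ Set.Icc (0 : ℝ) 1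
  · refine mul_le_mul ?_ (hC _ ht) (abs_nonneg _) (by norm_num)
    rw [abs_le]
    constructor <;> linarith [ht.1, ht.2]
  · have : t - 1 < 0 ∨ 1 < t - 1 := by
      by_contra! h
      exact ht h
    rw [deriv_smoothTransition_eq_zero this]
    simpa using hC0

/-- The derivatives of the cut-off sines are bounded uniformly in the cut-off parameter: where the
cut-off has slope of order `n`, the sine is of order `1 / n`. -/
lemma exists_deriv_cutSin_le (k : ℕ) : ∃ C, ∀ n : ℝ, 0 < n → ∀ x, |deriv (cutSin n k) x| ≤ C := by
  obtain ⟨C, hC⟩ := exists_mul_deriv_smoothTransition_le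
  have hC0 : 0 ≤ C := le_trans (by positivity) (hC 0)
  refine ⟨k * C + k * C + k, fun n hn x => ?_⟩
  have hst : ∀ t, HasDerivAt Real.smoothTransition (deriv Real.smoothTransition t) t := fun t =>
    ((Real.smoothTransition.contDiff (n := 1)).differentiable (by simp) t).hasDerivAt
  set y := 2 * Real.pi - x with hy
  have d1 : HasDerivAt (fun x => Real.smoothTransition (n * x - 1))
      (deriv Real.smoothTransition (n * x - 1) * n) x := by
    have h : HasDerivAt (fun x : ℝ => n * x - 1) n x := by
      simpa using ((hasDerivAt_id x).const_mul n).sub_const 1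
    exact (hst _).comp x h
  have d2 : HasDerivAt (fun x => Real.smoothTransition (n * (2 * Real.pi - x) - 1))
      (deriv Real.smoothTransition (n * y - 1) * -n) x := by
    have h : HasDerivAt (fun x : ℝ => n * (2 * Real.pi - x) - 1) (-n) x := by
      simpa using (((hasDerivAt_id x).const_sub (2 * Real.pi)).const_mul n).sub_const 1
    exact (hst _).comp x h
  have d := (d1.mul d2).mul (hasDerivAt_sin_mul k x)
  have e : deriv (cutSin n k) x = _ := d.deriv
  rw [e]
  have s1 : |Real.sin (k * x)| ≤ k * |x| := by
    refine (Real.abs_sin_le_abs).trans (le_of_eq ?_)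
    rw [abs_mul, Nat.abs_cast]
  have s2 : |Real.sin (k * x)| ≤ k * |y| := by
    have : Real.sin (k * x) = -Real.sin (k * y) := by
      rw [hy, mul_sub, Real.sin_nat_mul_two_pi_sub, neg_neg]
    rw [this, abs_neg]
    refine (Real.abs_sin_le_abs).trans (le_of_eq ?_)
    rw [abs_mul, Nat.abs_cast]
  have bd : ∀ z, |Real.sin (k * x)| ≤ k * |z| →
      |deriv Real.smoothTransition (n * z - 1) * n * Real.sin (k * x)| ≤ k * C := by
    intro z hz
    have h := hC (n * z)
    rw [abs_mul, abs_of_pos hn] at h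
    rw [abs_mul, abs_mul, abs_of_pos hn]
    calc _ ≤ |deriv Real.smoothTransition (n * z - 1)| * n * (k * |z|) :=
          mul_le_mul_of_nonneg_left hz (by positivity)
      _ = k * (n * |z| * |deriv Real.smoothTransition (n * z - 1)|) := by ring
      _ ≤ k * C := mul_le_mul_of_nonneg_left h (by positivity)
  have st : ∀ t, |Real.smoothTransition t| ≤ 1 := fun t => by
    rw [abs_of_nonneg (Real.smoothTransition.nonneg _)]
    exact Real.smoothTransition.le_one _
  have t1 := bd x s1
  have t2 := bd y s2
  have hcut : |cutoff n x| ≤ 1 := by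
    rw [abs_of_nonneg (cutoff_mem_Icc n x).1]
    exact (cutoff_mem_Icc n x).2
  have r1 : |deriv Real.smoothTransition (n * x - 1) * n * Real.sin (k * x)
      * Real.smoothTransition (n * y - 1)| ≤ k * C := by
    rw [abs_mul]
    exact (mul_le_of_le_one_right (abs_nonneg _) (st _)).trans t1
  have r2 : |deriv Real.smoothTransition (n * y - 1) * n * Real.sin (k * x)
      * Real.smoothTransition (n * x - 1)| ≤ k * C := by
    rw [abs_mul]
    exact (mul_le_of_le_one_right (abs_nonneg _) (st _)).trans t2
  have r3 : |cutoff n x * (k * Real.cos (k * x))| ≤ k := by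
    rw [abs_mul, abs_mul, Nat.abs_cast]
    have hcos := Real.abs_cos_le_one (k * x)
    calc _ ≤ 1 * ((k : ℝ) * 1) := by gcongr
      _ = k := by ring
  refine le_trans (le_of_eq ?_) ((abs_add_le _ _).trans
    (add_le_add ((abs_sub _ _).trans (add_le_add r1 r2)) r3))
  congr 1
  simp only [cutoff, Pi.mul_apply, ← hy]
  ring

/-- A cut-off sine mode, compactly supported in the open square. -/
noncomputable def cutMode (k l : ℕ) (n : ℕ) (p : ℝ × ℝ) : ℝ :=
  cutSin (n + 1) k p.1 * cutSin (n + 1) l p.2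

lemma isTest_cutMode (k l n : ℕ) : IsTest (cutMode k l n) := by
  have hn : (0 : ℝ) < n + 1 := by positivity
  set K : Set (ℝ × ℝ) := Set.Icc (1 / ((n : ℝ) + 1)) (2 * Real.pi - 1 / (n + 1)) ×ˢ
    Set.Icc (1 / ((n : ℝ) + 1)) (2 * Real.pi - 1 / (n + 1)) with hK
  have hKc : IsCompact K := isCompact_Icc.prod isCompact_Icc
  have hs : Function.support (cutMode k l n) ⊆ K := fun p hp =>
    ⟨cutSin_support hn k (left_ne_zero_of_mul hp), cutSin_support hn l (right_ne_zero_of_mul hp)⟩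
  have hpos : (0 : ℝ) < 1 / (n + 1) := by positivity
  refine ⟨?_, HasCompactSupport.of_support_subset_isCompact hKc hs,
    (closure_minimal hs hKc.isClosed).trans fun p hp => ?_⟩
  · exact ((cutSin_smooth _ _).comp contDiff_fst).mul ((cutSin_smooth _ _).comp contDiff_snd)
  · rw [square, interior_prod_eq, interior_Icc]
    exact ⟨⟨by linarith [hp.1.1], by linarith [hp.1.2]⟩,
      ⟨by linarith [hp.2.1], by linarith [hp.2.2]⟩⟩

lemma ae_mem_interior : ∀ᵐ p ∂area,
    p.1 ∈ Set.Ioo 0 (2 * Real.pi) ∧ p.2 ∈ Set.Ioo 0 (2 * Real.pi) := by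
  have e : area = volume.restrict
      (Set.Ioo 0 (2 * Real.pi) ×ˢ Set.Ioo 0 (2 * Real.pi) : Set (ℝ × ℝ)) := by
    rw [area_eq_prod, ← restrict_Ioo_eq_restrict_Icc, Measure.prod_restrict]
    rfl
  rw [e]
  exact (ae_restrict_iff' (measurableSet_Ioo.prod measurableSet_Ioo)).2 (.of_forall fun p hp => hp)

lemma tendsto_cutSin {x : ℝ} (hx : x ∈ Set.Ioo 0 (2 * Real.pi)) (k : ℕ) :
    Tendsto (fun n : ℕ => cutSin (n + 1) k x) atTop (𝓝 (Real.sin (k * x))) ∧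
      Tendsto (fun n : ℕ => deriv (cutSin (n + 1) k) x) atTop (𝓝 (k * Real.cos (k * x))) := by
  have h : ∀ᶠ n : ℕ in atTop, cutSin (n + 1) k =ᶠ[𝓝 x] fun y => Real.sin (k * y) := by
    filter_upwards [cutoff_eventuallyEq_one hx] with n hn
    filter_upwards [hn] with y hy
    simp [cutSin, hy]
  constructor
  · refine tendsto_const_nhds.congr' ?_
    filter_upwards [h] with n hn
    exact hn.eq_of_nhds.symm
  · refine tendsto_const_nhds.congr' ?_
    filter_upwards [h] with n hn
    rw [hn.deriv_eq, (hasDerivAt_sin_mul k x).deriv]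

lemma partials_cutMode (k l n : ℕ) (p : ℝ × ℝ) :
    dx (cutMode k l n) p = deriv (cutSin (n + 1) k) p.1 * cutSin (n + 1) l p.2 ∧
      dy (cutMode k l n) p = cutSin (n + 1) k p.1 * deriv (cutSin (n + 1) l) p.2 :=
  partials_mul (((cutSin_smooth _ _).differentiable (by simp) _).hasDerivAt)
    (((cutSin_smooth _ _).differentiable (by simp) _).hasDerivAt)

lemma tendsto_ip {f g : ℝ × ℝ → ℝ} {φ : ℕ → ℝ × ℝ → ℝ} (hf : MemLp f 2 area)
    (hφ : ∀ n, Continuous (φ n)) {C : ℝ} (hC : ∀ n p, |φ n p| ≤ C)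
    (hlim : ∀ᵐ p ∂area, Tendsto (fun n => φ n p) atTop (𝓝 (g p))) :
    Tendsto (fun n => ip f (φ n)) atTop (𝓝 (ip f g)) := by
  refine tendsto_integral_of_dominated_convergence (fun p => |f p| * C)
    (fun n => hf.1.mul (hφ n).aestronglyMeasurable)
    ((hf.integrable (by norm_num)).abs.mul_const C) (fun n => .of_forall fun p => ?_) ?_
  · rw [Real.norm_eq_abs, abs_mul]
    exact mul_le_mul_of_nonneg_left (hC n p) (abs_nonneg _)
  · filter_upwards [hlim] with p hp
    exact hp.const_mul _

/-- A weak gradient may be tested against sine modes, which vanish on the boundary without having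
compact support. -/
lemma IsWeakGrad.sinMode {f g h : ℝ × ℝ → ℝ} (hw : IsWeakGrad f g h) (hf : MemLp f 2 area)
    (hg : MemLp g 2 area) (hh : MemLp h 2 area) (k l : ℕ) :
    ip f (dx (sinMode k l)) = -ip g (sinMode k l) ∧
      ip f (dy (sinMode k l)) = -ip h (sinMode k l) := by
  obtain ⟨C, hC⟩ := exists_deriv_cutSin_le k
  obtain ⟨C', hC'⟩ := exists_deriv_cutSin_le l
  have hC0 : 0 ≤ C := (abs_nonneg _).trans (hC 1 one_pos 0)
  have hpos : ∀ n : ℕ, (0 : ℝ) < n + 1 := fun n => by positivity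
  have hs : ∀ (n : ℝ) (k : ℕ) (x : ℝ), |cutSin n k x| ≤ 1 := by
    intro n k x
    rw [cutSin, abs_mul, abs_of_nonneg (cutoff_mem_Icc n x).1]
    exact mul_le_one₀ (cutoff_mem_Icc n x).2 (abs_nonneg _) (Real.abs_sin_le_one _)
  have hsm := fun n => (isTest_cutMode k l n).1
  have t0 : ∀ q, MemLp q 2 area →
      Tendsto (fun n => ip q (cutMode k l n)) atTop (𝓝 (ip q (CCH.sinMode k l))) := by
    intro q hq
    refine tendsto_ip hq (fun n => (hsm n).continuous) (C := 1) (fun n p => ?_) ?_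
    · rw [cutMode, abs_mul]
      exact mul_le_one₀ (hs _ _ _) (abs_nonneg _) (hs _ _ _)
    · filter_upwards [ae_mem_interior] with p hp
      exact (tendsto_cutSin hp.1 k).1.mul (tendsto_cutSin hp.2 l).1
  have tx : Tendsto (fun n => ip f (dx (cutMode k l n))) atTop
      (𝓝 (ip f (dx (CCH.sinMode k l)))) := by
    refine tendsto_ip hf (fun n => (smooth_pd (v := (1, 0)) (hsm n)).continuous) (C := C)
      (fun n p => ?_) ?_
    · rw [(partials_cutMode k l n p).1, abs_mul]
      exact (mul_le_of_le_one_right (abs_nonneg _) (hs _ _ _)).trans (hC _ (hpos n) _)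
    · filter_upwards [ae_mem_interior] with p hp
      simp only [(partials_cutMode k l _ p).1, dx_sinMode]
      exact (tendsto_cutSin hp.1 k).2.mul (tendsto_cutSin hp.2 l).1
  have ty : Tendsto (fun n => ip f (dy (cutMode k l n))) atTop
      (𝓝 (ip f (dy (CCH.sinMode k l)))) := by
    refine tendsto_ip hf (fun n => (smooth_pd (v := (0, 1)) (hsm n)).continuous) (C := C')
      (fun n p => ?_) ?_
    · rw [(partials_cutMode k l n p).2, abs_mul]
      exact (mul_le_of_le_one_left (abs_nonneg _) (hs _ _ _)).trans (hC' _ (hpos n) _)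
    · filter_upwards [ae_mem_interior] with p hp
      simp only [(partials_cutMode k l _ p).2, dy_sinMode]
      exact (tendsto_cutSin hp.1 k).1.mul (tendsto_cutSin hp.2 l).2
  constructor
  · exact tendsto_nhds_unique (tx.congr fun n => (hw _ (isTest_cutMode k l n)).1) (t0 g hg).neg
  · exact tendsto_nhds_unique (ty.congr fun n => (hw _ (isTest_cutMode k l n)).2) (t0 h hh).neg

/-- Two square integrable functions with the same integrals against test functions agree. -/
lemma ae_eq_of_forall_ip_eq {g g' : ℝ × ℝ → ℝ} (hg : MemLp g 2 area) (hg' : MemLp g' 2 area)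
    (h : ∀ η, IsTest η → ip g η = ip g' η) : g =ᵐ[area] g' := by
  have hd : MemLp (g - g') 2 area := hg.sub hg'
  have key := IsOpen.ae_eq_zero_of_integral_contDiff_smul_eq_zero (μ := area)
    (isOpen_interior (s := square))
    ((hd.integrable (by norm_num)).locallyIntegrable.locallyIntegrableOn _)
    (fun η h1 h2 h3 => by
      have e := h η ⟨h1, h2, h3⟩
      have := ip_sub_left hg hg' (memLp_of_continuous h1.continuous)
      rw [e, sub_self, ip_comm] at this
      exact this)
  filter_upwards [key, ae_mem_interior] with p hp hi
  have : p ∈ interior square := by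
    rw [square, interior_prod_eq, interior_Icc]
    exact hi
  exact sub_eq_zero.1 (hp this)

lemma tendsto_ip_of_tendsto_eLpNorm {f g : ℝ × ℝ → ℝ} {φ : ℕ → ℝ × ℝ → ℝ} (hf : MemLp f 2 area)
    (hφ : ∀ n, MemLp (φ n) 2 area) (hg : MemLp g 2 area)
    (hlim : Tendsto (fun n => eLpNorm (f - φ n) 2 area) atTop (𝓝 0)) :
    Tendsto (fun n => ip (φ n) g) atTop (𝓝 (ip f g)) := by
  have hself : ∀ q, MemLp q 2 area → ip q q = (eLpNorm q 2 area).toReal ^ 2 := by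
    intro q hq
    have h0 : 0 ≤ ∫ a, ‖q a‖ ^ (2 : ℝ) ∂area := integral_nonneg fun _ => by positivity
    rw [hq.eLpNorm_eq_integral_rpow_norm (by norm_num) (by norm_num)]
    simp only [ENNReal.toReal_ofNat]
    rw [ENNReal.toReal_ofReal (by positivity), ← Real.rpow_natCast, ← Real.rpow_mul h0]
    simp [ip, ← sq]
  have hb : ∀ n, |ip (φ n) g - ip f g|
      ≤ (eLpNorm (f - φ n) 2 area).toReal * Real.sqrt (ip g g) := by
    intro n
    have hcs := ip_sq_le (hf.sub (hφ n)) hg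
    rw [hself _ (hf.sub (hφ n)), ip_sub_left hf (hφ n) hg] at hcs
    refine abs_le_of_sq_le_sq ?_ (by positivity)
    rw [mul_pow, Real.sq_sqrt (ip_self_nonneg g)]
    nlinarith
  rw [tendsto_iff_dist_tendsto_zero]
  have h1 : Tendsto (fun n => (eLpNorm (f - φ n) 2 area).toReal) atTop (𝓝 0) := by
    exact (ENNReal.tendsto_toReal ENNReal.zero_ne_top).comp hlim
  refine squeeze_zero (fun _ => dist_nonneg) (fun n => ?_)
    (by simpa using h1.mul_const (Real.sqrt (ip g g)))
  rw [Real.dist_eq]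
  exact hb n

lemma ip_dx_test {η z : ℝ × ℝ → ℝ} (hη : IsTest η) (hz : ContDiff ℝ ∞ z) :
    ip η (dx z) = -ip (dx η) z ∧ ip η (dy z) = -ip (dy η) z := by
  have h0 : ∀ p : ℝ × ℝ, p ∉ interior square → η p = 0 := fun p hp =>
    image_eq_zero_of_notMem_tsupport fun h => hp (hη.2.2 h)
  have hint : interior square = Set.Ioo 0 (2 * Real.pi) ×ˢ Set.Ioo 0 (2 * Real.pi) := by
    rw [square, interior_prod_eq, interior_Icc]
  rw [hint] at h0
  have c0 := hη.1.continuous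
  have c1 := hz.continuous
  constructor
  · have h := integral_dx_eq_zero (f := η * z) (hη.1.mul hz) fun y _ => by
      simp [h0 (0, y) (by simp), h0 (2 * Real.pi, y) (by simp)]
    have c2 : Continuous (dx η) := (smooth_pd (v := (1, 0)) hη.1).continuous
    have c3 : Continuous (dx z) := (smooth_pd (v := (1, 0)) hz).continuous
    rw [dx_eq_pd, pd_mul hη.1 hz, ← dx_eq_pd, ← dx_eq_pd,
      integral_add' (integrable_of_continuous (c2.mul c1))
        (integrable_of_continuous (c0.mul c3))] at h
    simp only [Pi.mul_apply] at h
    simp only [ip]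
    linarith
  · have h := integral_dy_eq_zero (f := η * z) (hη.1.mul hz) fun x _ => by
      simp [h0 (x, 0) (by simp), h0 (x, 2 * Real.pi) (by simp)]
    have c2 : Continuous (dy η) := (smooth_pd (v := (0, 1)) hη.1).continuous
    have c3 : Continuous (dy z) := (smooth_pd (v := (0, 1)) hz).continuous
    rw [dy_eq_pd, pd_mul hη.1 hz, ← dy_eq_pd, ← dy_eq_pd,
      integral_add' (integrable_of_continuous (c2.mul c1))
        (integrable_of_continuous (c0.mul c3))] at h
    simp only [Pi.mul_apply] at h
    simp only [ip]
    linarith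

/-- Functions in `H² ∩ H¹₀` have a weak Laplacian in `L²` that may be tested against the spectral
spaces. The condition `H¹₀` removes the boundary term of the first integration by parts, and the
vanishing of the modes on the boundary removes that of the second. -/
lemma exists_weak_lap {u₀ : ℝ × ℝ → ℝ} (h2 : MemH2 u₀) (h10 : MemH10 u₀) :
    ∃ q, MemLp q 2 area ∧ ∀ m, ∀ z ∈ specSpace m, ip u₀ (lap z) = ip q z := by
  obtain ⟨hu, g, h, ⟨hg, gx, gy, hgx, hgy, hgw⟩, ⟨hh, hx, hy, hhx, hhy, hhw⟩, hw⟩ := h2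
  obtain ⟨-, g', h', hg', hh', hw', η, hη, hη0, hηx, hηy⟩ := h10
  have eg : g =ᵐ[area] g' := ae_eq_of_forall_ip_eq hg hg' fun η ht => by
    linarith [(hw η ht).1, (hw' η ht).1]
  have eh : h =ᵐ[area] h' := ae_eq_of_forall_ip_eq hh hh' fun η ht => by
    linarith [(hw η ht).2, (hw' η ht).2]
  have hq : MemLp (gx + hy) 2 area := hgx.add hhy
  refine ⟨gx + hy, hq, fun m z hz => ?_⟩
  induction hz using Submodule.span_induction with
  | mem f hf =>
    obtain ⟨k, -, l, -, rfl⟩ := hf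
    set s := sinMode k l
    have ps : Per s := per_sinMode k l
    have mη : ∀ n, MemLp (η n) 2 area := fun n => memLp_of_continuous (hη n).1.continuous
    have mx : ∀ n, MemLp (dx (η n)) 2 area := fun n =>
      memLp_of_continuous (smooth_pd (v := (1, 0)) (hη n).1).continuous
    have my : ∀ n, MemLp (dy (η n)) 2 area := fun n =>
      memLp_of_continuous (smooth_pd (v := (0, 1)) (hη n).1).continuous
    have msx := memLp_of_continuous ps.dx.continuous
    have msy := memLp_of_continuous ps.dy.continuous
    have msxx := memLp_of_continuous ps.dx.dx.continuous
    have msyy := memLp_of_continuous ps.dy.dy.continuous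
    have e1 : ∀ n, ip (η n) (lap s) = -ip (dx (η n)) (dx s) - ip (dy (η n)) (dy s) := fun n => by
      have h : lap s = dx (dx s) + dy (dy s) := rfl
      rw [h, ip_add_right (mη n) msxx msyy, (ip_dx_test (hη n) ps.dx.smooth).1,
        (ip_dx_test (hη n) ps.dy.smooth).2]
      ring
    have l1 := tendsto_ip_of_tendsto_eLpNorm hu mη (memLp_of_continuous ps.lap.continuous) hη0
    have l2 := tendsto_ip_of_tendsto_eLpNorm hg' mx msx hηx
    have l3 := tendsto_ip_of_tendsto_eLpNorm hh' my msy hηy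
    have e2 := tendsto_nhds_unique (l1.congr e1) (l2.neg.sub l3)
    have e3 : ip g' (dx s) = ip g (dx s) := integral_congr_ae (by
      filter_upwards [eg] with p hp
      rw [hp])
    have e4 : ip h' (dy s) = ip h (dy s) := integral_congr_ae (by
      filter_upwards [eh] with p hp
      rw [hp])
    rw [e2, e3, e4, (hgw.sinMode hg hgx hgy k l).1, (hhw.sinMode hh hhx hhy k l).2,
      ip_add_left hgx hhy (memLp_of_continuous ps.continuous)]
    ring
  | zero =>
    have : lap (0 : ℝ × ℝ → ℝ) = 0 := by simpa using lap_smul 0 (Per.const 0)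
    rw [this]
    simp [ip]
  | add f g hf' hg' hf hg =>
    have pf : Per f := per_of_mem_specSpace hf'
    have pg : Per g := per_of_mem_specSpace hg'
    rw [lap_add pf pg, ip_add_right hu (memLp_of_continuous pf.lap.continuous)
      (memLp_of_continuous pg.lap.continuous), ip_add_right hq (memLp_of_continuous pf.continuous)
      (memLp_of_continuous pg.continuous), hf, hg]
  | smul c f hf' hf =>
    rw [lap_smul _ (per_of_mem_specSpace hf'), ip_smul_right, ip_smul_right, hf]

/-- The spectral projections of `u₀ ∈ H² ∩ H¹₀` are bounded in `L²`, and so are their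
Laplacians. -/
lemma exists_proj_bound {u₀ : ℝ × ℝ → ℝ} (h2 : MemH2 u₀) (h10 : MemH10 u₀) :
    ∃ R, ∀ m w, IsProj m u₀ w → ip w w ≤ R ∧ ip (lap w) (lap w) ≤ R := by
  obtain ⟨q, hq, hqz⟩ := exists_weak_lap h2 h10
  have hu := h2.1
  refine ⟨max (ip u₀ u₀) (ip q q), fun m w hw => ?_⟩
  have pw := per_of_mem_specSpace hw.1
  have mw := memLp_of_continuous pw.continuous
  have hproj : ∀ v ∈ specSpace m, ip w v = ip u₀ v := fun v hv => by
    have := hw.2 v hv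
    rw [ip_sub_left hu mw (memLp_of_continuous (per_of_mem_specSpace hv).continuous)] at this
    linarith
  have key : ∀ f g, MemLp f 2 area → MemLp g 2 area → ip g g = ip f g → ip g g ≤ ip f f := by
    intro f g hf hg he
    have hcs := ip_sq_le hf hg
    rw [← he] at hcs
    rcases (ip_self_nonneg g).eq_or_lt with h | h
    · rw [← h]; exact ip_self_nonneg f
    · exact le_of_mul_le_mul_right (by nlinarith) h
  constructor
  · exact (key u₀ w hu mw (hproj w hw.1)).trans (le_max_left _ _)
  · refine (key q (lap w) hq (memLp_of_continuous pw.lap.continuous) ?_).trans (le_max_right _ _)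
    have hl := lap_mem_specSpace hw.1
    rw [← hqz m _ hl, ← hproj _ (lap_mem_specSpace hl), ip_lap_comm pw pw.lap]

/-! ### One step of the scheme -/

section step
variable {γ γ₁ γ₂ Δt : ℝ} {m : ℕ} {a b : ℝ × ℝ → ℝ}

lemma deriv_phi (γ₁ γ₂ s : ℝ) : deriv (phi γ₁ γ₂) s = 3 * γ₂ * s ^ 2 + 2 * γ₁ * s - 1 := by
  have h1 := (hasDerivAt_pow 3 s).const_mul γ₂
  have h2 := (hasDerivAt_pow 2 s).const_mul γ₁
  have h := ((h1.add h2).sub (hasDerivAt_id s)).deriv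
  have e : phi γ₁ γ₂ = (fun s => γ₂ * s ^ 3) + (fun s => γ₁ * s ^ 2) - id := by
    ext s
    simp [phi]
  rw [e, h]
  push_cast
  ring

/-- The coefficient `φ'(a)` of the diffusion term. -/
noncomputable def diffusivity (γ₁ γ₂ : ℝ) (a : ℝ × ℝ → ℝ) : ℝ × ℝ → ℝ :=
  (3 * γ₂) • (a * a) + (2 * γ₁) • a - fun _ => 1

/-- The strong form `∇ · (φ'(a) ∇b) + (2/3) (a ∇ · b + ∇ · (a b))` of the lower order terms of the
scheme. -/
noncomputable def lowerOrder (γ₁ γ₂ : ℝ) (a b : ℝ × ℝ → ℝ) : ℝ × ℝ → ℝ :=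
  dx (diffusivity γ₁ γ₂ a * dx b) + dy (diffusivity γ₁ γ₂ a * dy b)
    + (2 / 3 : ℝ) • (a * sdiv b + sdiv (a * b))

lemma diffusivity_apply (γ₁ γ₂ : ℝ) (a : ℝ × ℝ → ℝ) (p : ℝ × ℝ) :
    diffusivity γ₁ γ₂ a p = deriv (phi γ₁ γ₂) (a p) := by
  rw [deriv_phi]
  simp only [diffusivity, Pi.add_apply, Pi.sub_apply, Pi.smul_apply, Pi.mul_apply, smul_eq_mul]
  ring

lemma Per.diffusivity (ha : Per a) : Per (diffusivity γ₁ γ₂ a) :=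
  (((ha.mul ha).const_smul _).add (ha.const_smul _)).sub (Per.const 1)

lemma Per.lowerOrder (ha : Per a) (hb : Per b) : Per (lowerOrder γ₁ γ₂ a b) :=
  ((ha.diffusivity.mul hb.dx).dx.add (ha.diffusivity.mul hb.dy).dy).add
    (((ha.mul hb.sdiv).add (ha.mul hb).sdiv).const_smul _)

lemma pd_diffusivity (ha : Per a) (v : ℝ × ℝ) (p : ℝ × ℝ) :
    pd v (diffusivity γ₁ γ₂ a) p = (6 * γ₂ * a p + 2 * γ₁) * pd v a p := by
  have h1 : HasDerivAt (fun s : ℝ => 3 * γ₂ * s ^ 2 + 2 * γ₁ * s - 1)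
      (6 * γ₂ * a p + 2 * γ₁) (a p) := by
    refine ((((hasDerivAt_pow 2 (a p)).const_mul (3 * γ₂)).add
      ((hasDerivAt_id' (a p)).const_mul (2 * γ₁))).sub_const 1).congr_deriv ?_
    push_cast
    ring
  have h2 := h1.comp_hasFDerivAt p (ha.smooth.differentiable (by simp) p).hasFDerivAt
  have e : diffusivity γ₁ γ₂ a = (fun s : ℝ => 3 * γ₂ * s ^ 2 + 2 * γ₁ * s - 1) ∘ a := by
    ext q
    rw [diffusivity_apply, deriv_phi]
    rfl
  rw [e, pd, h2.fderiv]
  rfl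

lemma lowerOrder_apply (ha : Per a) (hb : Per b) (p : ℝ × ℝ) :
    lowerOrder γ₁ γ₂ a b p = (3 * γ₂ * a p ^ 2 + 2 * γ₁ * a p - 1) * lap b p
      + (6 * γ₂ * a p + 2 * γ₁) * (dx a p * dx b p + dy a p * dy b p)
      + 2 / 3 * (2 * a p * (dx b p + dy b p) + b p * (dx a p + dy a p)) := by
  have hm := ha.diffusivity (γ₁ := γ₁) (γ₂ := γ₂)
  have e1 : dx (diffusivity γ₁ γ₂ a * dx b) = _ := pd_mul hm.smooth hb.dx.smooth
  have e2 : dy (diffusivity γ₁ γ₂ a * dy b) = _ := pd_mul hm.smooth hb.dy.smooth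
  have e3 : dx (a * b) = dx a * b + a * dx b := pd_mul ha.smooth hb.smooth
  have e4 : dy (a * b) = dy a * b + a * dy b := pd_mul ha.smooth hb.smooth
  simp only [lowerOrder, e1, e2, Pi.add_apply, Pi.mul_apply, Pi.smul_apply, smul_eq_mul,
    pd_diffusivity ha, diffusivity_apply, deriv_phi, sdiv, e3, e4, lap]
  simp only [← dx_eq_pd, ← dy_eq_pd]
  ring

/-- The scheme with the lower order terms integrated by parts. -/
lemma IsStep.strong (h : IsStep γ γ₁ γ₂ m Δt a b) (ha : Per a) (hb : Per b) {v : ℝ × ℝ → ℝ}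
    (hv : v ∈ specSpace m) :
    ip (b - a) v / Δt + γ * ip (lap b) (lap v) = ip (lowerOrder γ₁ γ₂ a b) v := by
  have pv := per_of_mem_specSpace hv
  have hm := ha.diffusivity (γ₁ := γ₁) (γ₂ := γ₂)
  have mv := memLp_of_continuous pv.continuous
  have h0 := h v hv
  have e1 : ip (fun p => (b p - a p) / Δt) v = ip (b - a) v / Δt := by
    have : (fun p => (b p - a p) / Δt) = Δt⁻¹ • (b - a) := by
      ext p
      simp only [Pi.smul_apply, Pi.sub_apply, smul_eq_mul]
      ring
    rw [this, ip_smul_left]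
    ring
  have e2 : ∫ p, deriv (phi γ₁ γ₂) (a p) * (dx b p * dx v p + dy b p * dy v p) ∂area
      = ip (diffusivity γ₁ γ₂ a * dx b) (dx v) + ip (diffusivity γ₁ γ₂ a * dy b) (dy v) := by
    rw [ip, ip, ← integral_add
      (memLp_integrable_mul (memLp_of_continuous (hm.mul hb.dx).continuous)
        (memLp_of_continuous pv.dx.continuous))
      (memLp_integrable_mul (memLp_of_continuous (hm.mul hb.dy).continuous)
        (memLp_of_continuous pv.dy.continuous))]
    refine integral_congr_ae (.of_forall fun p => ?_)
    simp only [← diffusivity_apply, Pi.mul_apply]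
    ring
  have e3 : ip (diffusivity γ₁ γ₂ a * dx b) (dx v) = -ip (dx (diffusivity γ₁ γ₂ a * dx b)) v := by
    have : ip (dx (diffusivity γ₁ γ₂ a * dx b)) v = _ := ip_pd_left isPerDir_x (hm.mul hb.dx) pv
    rw [this, neg_neg]; rfl
  have e4 : ip (diffusivity γ₁ γ₂ a * dy b) (dy v) = -ip (dy (diffusivity γ₁ γ₂ a * dy b)) v := by
    have : ip (dy (diffusivity γ₁ γ₂ a * dy b)) v = _ := ip_pd_left isPerDir_y (hm.mul hb.dy) pv
    rw [this, neg_neg]; rfl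
  have e5 : ip (fun p => a p * b p) (sdiv v) = -ip (sdiv (a * b)) v := by
    have hab := ha.mul hb
    have h1 : ip (dx (a * b)) v = -ip (a * b) (dx v) := ip_pd_left isPerDir_x hab pv
    have h2 : ip (dy (a * b)) v = -ip (a * b) (dy v) := ip_pd_left isPerDir_y hab pv
    have h3 : ip (sdiv (a * b)) v = ip (dx (a * b)) v + ip (dy (a * b)) v :=
      ip_add_left (memLp_of_continuous hab.dx.continuous) (memLp_of_continuous hab.dy.continuous) mv
    have h4 : ip (a * b) (sdiv v) = ip (a * b) (dx v) + ip (a * b) (dy v) :=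
      ip_add_right (memLp_of_continuous hab.continuous) (memLp_of_continuous pv.dx.continuous)
        (memLp_of_continuous pv.dy.continuous)
    have h5 : ip (fun p => a p * b p) (sdiv v) = ip (a * b) (sdiv v) := rfl
    rw [h5, h3, h1, h2, h4]
    ring
  have e6 : ip (fun p => a p * sdiv b p) v = ip (a * sdiv b) v := rfl
  have e7 : ip (lowerOrder γ₁ γ₂ a b) v = ip (dx (diffusivity γ₁ γ₂ a * dx b)) v
      + ip (dy (diffusivity γ₁ γ₂ a * dy b)) v
      + 2 / 3 * (ip (a * sdiv b) v + ip (sdiv (a * b)) v) := by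
    have l1 := memLp_of_continuous (hm.mul hb.dx).dx.continuous
    have l2 := memLp_of_continuous (hm.mul hb.dy).dy.continuous
    have l3 := memLp_of_continuous (ha.mul hb.sdiv).continuous
    have l4 := memLp_of_continuous (ha.mul hb).sdiv.continuous
    rw [lowerOrder, ip_add_left (l1.add l2) ((l3.add l4).const_smul _) mv,
      ip_add_left l1 l2 mv, ip_smul_left, ip_add_left l3 l4 mv]
  rw [e1, e2, e3, e4, e5, e6] at h0
  rw [e7]
  linarith

lemma two_mul_ip_sub {f g : ℝ × ℝ → ℝ} (hf : Continuous f) (hg : Continuous g) :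
    2 * ip (g - f) g = ip g g - ip f f + ip (g - f) (g - f) := by
  have mf := memLp_of_continuous hf
  have mg := memLp_of_continuous hg
  rw [ip_sub_left mg mf (mg.sub mf), ip_comm g (g - f), ip_comm f (g - f),
    ip_sub_left mg mf mg, ip_sub_left mg mf mf, ip_comm f g]
  ring

lemma gradSq_eq_integral (hb : Per b) : gradSq b = ∫ p, gradLen b p ∂area := by
  rw [gradSq, ip, ip, ← integral_add
    (memLp_integrable_mul (memLp_of_continuous hb.dx.continuous)
      (memLp_of_continuous hb.dx.continuous))
    (memLp_integrable_mul (memLp_of_continuous hb.dy.continuous)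
      (memLp_of_continuous hb.dy.continuous))]
  rfl

/-- The energy inequality: the scheme tested with the new iterate. The convective terms cancel, and
`φ'(s) ≥ γ₂ s² - (1 + γ₁² / (2 γ₂))`. -/
lemma IsStep.energy (h : IsStep γ γ₁ γ₂ m Δt a b) (hγ₂ : 0 < γ₂) (hΔt : 0 < Δt) (ha : Per a)
    (hb : b ∈ specSpace m) :
    ip b b - ip a a + ip (b - a) (b - a) + 2 * Δt * (γ * ip (lap b) (lap b)
      + γ₂ * ip (a * gradLen b) a - (1 + γ₁ ^ 2 / (2 * γ₂)) * gradSq b) ≤ 0 := by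
  have pb := per_of_mem_specSpace hb
  have h0 := h b hb
  set c := 1 + γ₁ ^ 2 / (2 * γ₂) with hc
  have e1 : ip (fun p => (b p - a p) / Δt) b = ip (b - a) b / Δt := by
    have : (fun p => (b p - a p) / Δt) = Δt⁻¹ • (b - a) := by
      ext p
      simp only [Pi.smul_apply, Pi.sub_apply, smul_eq_mul]
      ring
    rw [this, ip_smul_left]
    ring
  have e2 : ip (fun p => a p * sdiv b p) b = ip (fun p => a p * b p) (sdiv b) :=
    integral_congr_ae (.of_forall fun p => by ring)
  have e3 : γ₂ * ip (a * gradLen b) a - c * gradSq b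
      ≤ ∫ p, deriv (phi γ₁ γ₂) (a p) * (dx b p * dx b p + dy b p * dy b p) ∂area := by
    have i1 : Integrable (fun p => γ₂ * ((a * gradLen b) p * a p)) area :=
      (integrable_of_continuous ((ha.mul pb.gradLen).mul ha).continuous).const_mul _
    have i2 : Integrable (fun p => c * gradLen b p) area :=
      (integrable_of_continuous pb.gradLen.continuous).const_mul _
    rw [ip, gradSq_eq_integral pb, ← integral_const_mul, ← integral_const_mul,
      ← integral_sub i1 i2]
    simp only [← diffusivity_apply]
    refine integral_mono (i1.sub i2)
      (integrable_of_continuous (ha.diffusivity.mul pb.gradLen).continuous) fun p => ?_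
    have hg : 0 ≤ gradLen b p := add_nonneg (mul_self_nonneg _) (mul_self_nonneg _)
    have hphi : 0 ≤ diffusivity γ₁ γ₂ a p - (γ₂ * a p ^ 2 - c) := by
      have : diffusivity γ₁ γ₂ a p - (γ₂ * a p ^ 2 - c) = (2 * γ₂ * a p + γ₁) ^ 2 / (2 * γ₂) := by
        rw [diffusivity_apply, deriv_phi, hc]
        field_simp
        ring
      rw [this]
      positivity
    have := mul_nonneg hphi hg
    have e : dx b p * dx b p + dy b p * dy b p = gradLen b p := rfl
    simp only [Pi.mul_apply, e]
    nlinarith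
  have e4 := two_mul_ip_sub ha.continuous pb.continuous
  rw [e1, e2] at h0
  have e5 : ip (b - a) b = Δt * (ip (b - a) b / Δt) := by field_simp
  have e6 := mul_le_mul_of_nonneg_left e3 hΔt.le
  have e7 := congrArg (Δt * ·) h0
  simp only [mul_zero] at e7
  nlinarith

/-- The scheme tested with `Δ² b`. -/
lemma IsStep.lap_le (h : IsStep γ γ₁ γ₂ m Δt a b) (hγ : 0 < γ) (hΔt : 0 < Δt) (ha : Per a)
    (hb : b ∈ specSpace m) :
    ip (lap b) (lap b) ≤ ip (lap a) (lap a)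
      + Δt / (2 * γ) * ip (lowerOrder γ₁ γ₂ a b) (lowerOrder γ₁ γ₂ a b) := by
  have pb := per_of_mem_specSpace hb
  have h0 := h.strong ha pb (lap_mem_specSpace (lap_mem_specSpace hb))
  set N := lowerOrder γ₁ γ₂ a b
  have pN : Per N := ha.lowerOrder pb
  set Z := ip (lap (lap b)) (lap (lap b))
  have e1 : ip (lap b) (lap (lap (lap b))) = Z := ip_lap_comm pb.lap pb.lap.lap
  have e2 : ip (b - a) (lap (lap b)) = ip (lap b - lap a) (lap b) := by
    have l1 := memLp_of_continuous pb.lap.lap.continuous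
    have l2 := memLp_of_continuous pb.lap.continuous
    have l3 := memLp_of_continuous ha.lap.continuous
    rw [ip_sub_left (memLp_of_continuous pb.continuous) (memLp_of_continuous ha.continuous) l1,
      ip_sub_left l2 l3 l2, ip_lap_comm pb pb.lap, ip_lap_comm ha pb.lap]
  have e3 := two_mul_ip_sub ha.lap.continuous pb.lap.continuous
  have hcs := ip_sq_le (memLp_of_continuous pN.continuous)
    (memLp_of_continuous pb.lap.lap.continuous)
  have hZ : 0 ≤ Z := ip_self_nonneg _
  have hN : 0 ≤ ip N N := ip_self_nonneg _
  have hyoung : ip N (lap (lap b)) ≤ γ * Z + ip N N / (4 * γ) := by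
    refine le_trans (le_abs_self _) (abs_le_of_sq_le_sq ?_ (by positivity))
    have : (γ * Z + ip N N / (4 * γ)) ^ 2 = (γ * Z - ip N N / (4 * γ)) ^ 2 + ip N N * Z := by
      field_simp
      ring
    rw [this]
    nlinarith [sq_nonneg (γ * Z - ip N N / (4 * γ))]
  rw [e1, e2] at h0
  have h1 : ip (lap b - lap a) (lap b) / Δt ≤ ip N N / (4 * γ) := by linarith
  rw [div_le_iff₀ hΔt] at h1
  have h2 := ip_self_nonneg (lap b - lap a)
  have h3 : Δt / (2 * γ) * ip N N = 2 * (ip N N / (4 * γ) * Δt) := by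
    field_simp
    ring
  rw [h3]
  linarith

end step

/-! ### Bound on the lower order terms -/

lemma lowerOrder_sq_le (γ₁ γ₂ : ℝ) {x y l ax ay bx by' mx my : ℝ} (hx : x ^ 2 ≤ mx)
    (hy : y ^ 2 ≤ my) :
    ((3 * γ₂ * x ^ 2 + 2 * γ₁ * x - 1) * l + (6 * γ₂ * x + 2 * γ₁) * (ax * bx + ay * by')
      + 2 / 3 * (2 * x * (bx + by') + y * (ax + ay))) ^ 2
    ≤ 9 * (9 * γ₂ ^ 2 * mx ^ 2 + 4 * γ₁ ^ 2 * mx + 1) * l ^ 2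
      + (216 * γ₂ ^ 2 * mx + 24 * γ₁ ^ 2) * ((ax * ax + ay * ay) * (bx * bx + by' * by'))
      + 22 * mx * (bx * bx + by' * by') + 6 * my * (ax * ax + ay * ay) := by
  have hmx : 0 ≤ mx := (sq_nonneg x).trans hx
  have three : ∀ r s t : ℝ, (r + s + t) ^ 2 ≤ 3 * (r ^ 2 + s ^ 2 + t ^ 2) := fun r s t => by
    nlinarith [sq_nonneg (r - s), sq_nonneg (s - t), sq_nonneg (r - t)]
  have two : ∀ r s : ℝ, (r + s) ^ 2 ≤ 2 * (r ^ 2 + s ^ 2) := fun r s => by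
    nlinarith [sq_nonneg (r - s)]
  have hx2 : (x ^ 2) ^ 2 ≤ mx ^ 2 := pow_le_pow_left₀ (sq_nonneg x) hx 2
  have k1 : (3 * γ₂ * x ^ 2 + 2 * γ₁ * x - 1) ^ 2
      ≤ 3 * (9 * γ₂ ^ 2 * mx ^ 2 + 4 * γ₁ ^ 2 * mx + 1) := by
    have := three (3 * γ₂ * x ^ 2) (2 * γ₁ * x) (-1)
    nlinarith [mul_le_mul_of_nonneg_left hx2 (sq_nonneg γ₂),
      mul_le_mul_of_nonneg_left hx (sq_nonneg γ₁)]
  have k2 : (6 * γ₂ * x + 2 * γ₁) ^ 2 ≤ 2 * (36 * γ₂ ^ 2 * mx + 4 * γ₁ ^ 2) := by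
    have := two (6 * γ₂ * x) (2 * γ₁)
    nlinarith [mul_le_mul_of_nonneg_left hx (sq_nonneg γ₂)]
  have k3 : (ax * bx + ay * by') ^ 2 ≤ (ax * ax + ay * ay) * (bx * bx + by' * by') := by
    nlinarith [sq_nonneg (ax * by' - ay * bx)]
  have gA : 0 ≤ ax * ax + ay * ay := add_nonneg (mul_self_nonneg _) (mul_self_nonneg _)
  have gB : 0 ≤ bx * bx + by' * by' := add_nonneg (mul_self_nonneg _) (mul_self_nonneg _)
  have j1 := mul_le_mul_of_nonneg_right k1 (sq_nonneg l)
  have j2 := mul_le_mul k2 k3 (sq_nonneg _) (by positivity)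
  have j3 : (2 * x * (bx + by') + y * (ax + ay)) ^ 2
      ≤ 16 * mx * (bx * bx + by' * by') + 4 * my * (ax * ax + ay * ay) := by
    have i1 := two (2 * x * (bx + by')) (y * (ax + ay))
    have i2 : (bx + by') ^ 2 ≤ 2 * (bx * bx + by' * by') := by
      nlinarith [sq_nonneg (bx - by')]
    have i3 : (ax + ay) ^ 2 ≤ 2 * (ax * ax + ay * ay) := by
      nlinarith [sq_nonneg (ax - ay)]
    have i4 := mul_le_mul hx i2 (sq_nonneg _) hmx
    have i5 := mul_le_mul hy i3 (sq_nonneg _) ((sq_nonneg y).trans hy)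
    nlinarith
  have j4 := three ((3 * γ₂ * x ^ 2 + 2 * γ₁ * x - 1) * l)
    ((6 * γ₂ * x + 2 * γ₁) * (ax * bx + ay * by'))
    (2 / 3 * (2 * x * (bx + by') + y * (ax + ay)))
  have p1 := mul_nonneg hmx gB
  have p2 := mul_nonneg ((sq_nonneg y).trans hy) gA
  refine j4.trans ?_
  rw [mul_pow, mul_pow, mul_pow]
  linarith

/-- The constant of `ip_lowerOrder_le`. -/
noncomputable def lowerOrderConst (γ₁ γ₂ R : ℝ) : ℝ :=
  9 * (54 * γ₂ ^ 2 * R + 4 * γ₁ ^ 2 * (1 + 6 * R) + 1)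
    + (216 * γ₂ ^ 2 * (108 * R) + 24 * γ₁ ^ 2 * (45 * (1 + R))) + 28 * (3 * R)

/-- The arithmetic of `ip_lowerOrder_le`: `ma`, `mb` bound `a²`, `b²`, and `W`, `Ha`, `Hb` stand for
`∫ |∇a|² |∇b|²`, `‖∇a‖²`, `‖∇b‖²`. -/
lemma lowerOrder_scalar {γ₁ γ₂ R Ya Yb ma mb W Ha Hb : ℝ} (hR : 0 ≤ R) (hYa : 0 ≤ Ya)
    (hab : Ya ≤ Yb) (ma0 : 0 ≤ ma) (mb0 : 0 ≤ mb) (ma2 : ma ^ 2 = 6 * R * (1 + Ya))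
    (mb2 : mb ^ 2 = 6 * R * (1 + Yb)) (hW : W ^ 2 ≤ 324 * (ma * mb) * (Ya * Yb))
    (hHa : Ha ^ 2 ≤ R * (1 + Ya)) (hHb : Hb ^ 2 ≤ R * (1 + Yb)) :
    9 * (9 * γ₂ ^ 2 * ma ^ 2 + 4 * γ₁ ^ 2 * ma + 1) * Yb
      + (216 * γ₂ ^ 2 * ma + 24 * γ₁ ^ 2) * W + 22 * ma * Hb + 6 * mb * Ha
      ≤ lowerOrderConst γ₁ γ₂ R * ((1 + Ya) * (1 + Yb)) := by
  have hYb : 0 ≤ Yb := hYa.trans hab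
  obtain ⟨P, hP⟩ : ∃ P, P = 1 + Ya := ⟨_, rfl⟩
  obtain ⟨Q, hQ⟩ : ∃ Q, Q = 1 + Yb := ⟨_, rfl⟩
  rw [← hP] at ma2 hHa ⊢
  rw [← hQ] at mb2 hHb ⊢
  have hP1 : 1 ≤ P := by linarith
  have hPQ : P ≤ Q := by linarith
  have hQ1 : 1 ≤ Q := by linarith
  have hP0 : 0 ≤ P := by linarith
  have hQ0 : 0 ≤ Q := by linarith
  have hmm : ma * mb ≤ 6 * R * Q := by
    have : 6 * R * P ≤ 6 * R * Q := mul_le_mul_of_nonneg_left hPQ (by positivity)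
    nlinarith [sq_nonneg (ma - mb)]
  have hPQ1 : 1 ≤ P * Q := one_le_mul_of_one_le_of_one_le hP1 hQ1
  have hPQQ : P * Q ≤ (P * Q) ^ 2 := le_self_pow₀ hPQ1 (by norm_num)
  have hW2 : W ^ 2 ≤ 324 * (ma * mb) * (P * Q) := by
    have : Ya * Yb ≤ P * Q := mul_le_mul (by linarith) (by linarith) hYb hP0
    exact hW.trans (mul_le_mul_of_nonneg_left this (by positivity))
  have t1 : (9 * (9 * γ₂ ^ 2 * ma ^ 2 + 4 * γ₁ ^ 2 * ma + 1)) * Yb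
      ≤ 9 * (54 * γ₂ ^ 2 * R + 4 * γ₁ ^ 2 * (1 + 6 * R) + 1) * (P * Q) := by
    have s1 : ma ≤ (1 + 6 * R) * P := by nlinarith [sq_nonneg (ma - 1)]
    have s2 : (9 * (9 * γ₂ ^ 2 * ma ^ 2 + 4 * γ₁ ^ 2 * ma + 1))
        ≤ 9 * (54 * γ₂ ^ 2 * R + 4 * γ₁ ^ 2 * (1 + 6 * R) + 1) * P := by
      rw [ma2]
      nlinarith [mul_le_mul_of_nonneg_left s1 (sq_nonneg γ₁)]
    rw [← mul_assoc]
    exact mul_le_mul s2 (by linarith [hQ]) hYb (by positivity)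
  have t2 : (216 * γ₂ ^ 2 * ma + 24 * γ₁ ^ 2) * W
      ≤ (216 * γ₂ ^ 2 * (108 * R) + 24 * γ₁ ^ 2 * (45 * (1 + R))) * (P * Q) := by
    have s1 : ma * W ≤ 108 * R * (P * Q) := by
      refine le_of_sq_le_sq ?_ (by positivity)
      calc (ma * W) ^ 2 = ma ^ 2 * W ^ 2 := by ring
        _ ≤ 6 * R * P * (324 * (6 * R * Q) * (P * Q)) := by
          rw [ma2]
          refine mul_le_mul_of_nonneg_left (hW2.trans ?_) (by positivity)
          gcongr
        _ = (108 * R * (P * Q)) ^ 2 := by ring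
    have s2 : W ≤ 45 * (1 + R) * (P * Q) := by
      refine le_of_sq_le_sq ?_ (by positivity)
      calc W ^ 2 ≤ 324 * (6 * R * Q) * (P * Q) := hW2.trans (by gcongr)
        _ ≤ 324 * (6 * R * (P * Q)) * (P * Q) := by
          gcongr
          exact le_mul_of_one_le_left hQ0 hP1
        _ = 1944 * R * (P * Q) ^ 2 := by ring
        _ ≤ (45 * (1 + R)) ^ 2 * (P * Q) ^ 2 := by
          gcongr
          nlinarith
        _ = (45 * (1 + R) * (P * Q)) ^ 2 := by ring
    calc (216 * γ₂ ^ 2 * ma + 24 * γ₁ ^ 2) * W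
      _ = 216 * γ₂ ^ 2 * (ma * W) + 24 * γ₁ ^ 2 * W := by ring
      _ ≤ 216 * γ₂ ^ 2 * (108 * R * (P * Q)) + 24 * γ₁ ^ 2 * (45 * (1 + R) * (P * Q)) := by gcongr
      _ = _ := by ring
  have mixed : ∀ s t x y : ℝ, 0 ≤ x → s ^ 2 = 6 * R * x → t ^ 2 ≤ R * y → x * y = P * Q →
      s * t ≤ 3 * R * (P * Q) := by
    intro s t x y hx hs ht hxy
    refine le_trans (le_abs_self _) (abs_le_of_sq_le_sq ?_ (by positivity))
    calc (s * t) ^ 2 = s ^ 2 * t ^ 2 := by ring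
      _ ≤ 6 * R * x * (R * y) := by rw [hs]; gcongr
      _ = 6 * R ^ 2 * (x * y) := by ring
      _ ≤ 9 * R ^ 2 * (P * Q) ^ 2 := by
        rw [hxy]
        exact mul_le_mul (by nlinarith [sq_nonneg R]) hPQQ (by positivity) (by positivity)
      _ = _ := by ring
  have t3 := mixed ma Hb P Q hP0 ma2 hHb rfl
  have t4 := mixed mb Ha Q P hQ0 mb2 hHa (mul_comm _ _)
  rw [lowerOrderConst]
  linarith

/-- Where the Laplacian does not decrease, the square of the lower order terms is at most bilinear
in `‖Δa‖²` and `‖Δb‖²`; this is the critical growth that the logarithm in the Lyapunov functional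
below can absorb. -/
lemma ip_lowerOrder_le {γ₁ γ₂ R : ℝ} {m : ℕ} {a b : ℝ × ℝ → ℝ} (ha : a ∈ specSpace m)
    (hb : b ∈ specSpace m) (hR : 0 ≤ R) (haR : ip a a ≤ R) (hbR : ip b b ≤ R)
    (hab : ip (lap a) (lap a) ≤ ip (lap b) (lap b)) :
    ip (lowerOrder γ₁ γ₂ a b) (lowerOrder γ₁ γ₂ a b)
      ≤ lowerOrderConst γ₁ γ₂ R * ((1 + ip (lap a) (lap a)) * (1 + ip (lap b) (lap b))) := by
  have pa := per_of_mem_specSpace ha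
  have pb := per_of_mem_specSpace hb
  have hYa := ip_self_nonneg (lap a)
  have hYb := ip_self_nonneg (lap b)
  set Ya := ip (lap a) (lap a)
  set Yb := ip (lap b) (lap b)
  set P := 1 + Ya with hP
  set Q := 1 + Yb with hQ
  have hP0 : 0 ≤ P := by linarith
  have hQ0 : 0 ≤ Q := by linarith
  set ma := Real.sqrt (6 * R * P) with hma
  set mb := Real.sqrt (6 * R * Q) with hmb
  have ma0 : 0 ≤ ma := Real.sqrt_nonneg _
  have mb0 : 0 ≤ mb := Real.sqrt_nonneg _
  have ma2 : ma ^ 2 = 6 * R * P := Real.sq_sqrt (by positivity)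
  have mb2 : mb ^ 2 = 6 * R * Q := Real.sq_sqrt (by positivity)
  have sup : ∀ (u : ℝ × ℝ → ℝ) (S : ℝ), u ∈ specSpace m → ip u u ≤ R →
      ip (lap u) (lap u) ≤ S → ∀ p ∈ square, u p ^ 2 ≤ Real.sqrt (6 * R * S) := by
    intro u S hu huR huS p hp
    have h := pow_four_le (per_of_mem_specSpace hu) (eq_zero_of_mem_specSpace hu).1
      (eq_zero_of_mem_specSpace hu).2 hp
    refine Real.le_sqrt_of_sq_le (h.trans ?_)
    have := mul_le_mul huR huS (ip_self_nonneg _) hR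
    linarith
  have hma' := sup a P ha haR (by linarith)
  have hmb' := sup b Q hb hbR (by linarith)
  set C1 := 9 * (9 * γ₂ ^ 2 * ma ^ 2 + 4 * γ₁ ^ 2 * ma + 1)
  set C2 := 216 * γ₂ ^ 2 * ma + 24 * γ₁ ^ 2
  set W := ip (gradLen a) (gradLen b)
  have hint : ip (lowerOrder γ₁ γ₂ a b) (lowerOrder γ₁ γ₂ a b)
      ≤ C1 * Yb + C2 * W + 22 * ma * gradSq b + 6 * mb * gradSq a := by
    have c1 := (pb.lap.mul pb.lap).continuous
    have c2 := (pa.gradLen.mul pb.gradLen).continuous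
    have ca := pa.gradLen.continuous
    have cb := pb.gradLen.continuous
    have i1 : Integrable (fun p => C1 * (lap b * lap b) p) area :=
      (integrable_of_continuous c1).const_mul C1
    have i2 : Integrable (fun p => C2 * (gradLen a * gradLen b) p) area :=
      (integrable_of_continuous c2).const_mul C2
    have i3 : Integrable (fun p => 22 * ma * gradLen b p) area :=
      (integrable_of_continuous cb).const_mul _
    have i4 : Integrable (fun p => 6 * mb * gradLen a p) area :=
      (integrable_of_continuous ca).const_mul _
    have i12 : Integrable (fun p => C1 * (lap b * lap b) p
        + C2 * (gradLen a * gradLen b) p) area := i1.add i2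
    have i123 : Integrable (fun p => C1 * (lap b * lap b) p
        + C2 * (gradLen a * gradLen b) p + 22 * ma * gradLen b p) area := i12.add i3
    have e : C1 * Yb + C2 * W + 22 * ma * gradSq b + 6 * mb * gradSq a
        = ∫ p, (C1 * (lap b * lap b) p + C2 * (gradLen a * gradLen b) p
          + 22 * ma * gradLen b p + 6 * mb * gradLen a p) ∂area := by
      rw [integral_add i123 i4, integral_add i12 i3, integral_add i1 i2,
        integral_const_mul, integral_const_mul, integral_const_mul, integral_const_mul,
        ← gradSq_eq_integral pa, ← gradSq_eq_integral pb]
      rfl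
    rw [e]
    refine setIntegral_mono_on
      (integrable_of_continuous ((pa.lowerOrder pb).mul (pa.lowerOrder pb)).continuous)
      (i123.add i4) measurableSet_square fun p hp => ?_
    have := lowerOrder_sq_le γ₁ γ₂ (l := lap b p) (ax := dx a p) (ay := dy a p) (bx := dx b p)
      (by' := dy b p) (hma' p hp) (hmb' p hp)
    rw [lowerOrder_apply pa pb, ← sq]
    refine this.trans (le_of_eq ?_)
    simp only [gradLen, Pi.add_apply, Pi.mul_apply, C1, C2]
    ring
  have grad : ∀ u y, Per u → ip u u ≤ R → ip (lap u) (lap u) ≤ y → gradSq u ^ 2 ≤ R * y :=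
    fun u y hu h1 h2 => (gradSq_sq_le hu).trans (mul_le_mul h1 h2 (ip_self_nonneg _) hR)
  have hW2 : W ^ 2 ≤ 324 * (ma * mb) * (Ya * Yb) := by
    have h := ip_sq_le (memLp_of_continuous pa.gradLen.continuous)
      (memLp_of_continuous pb.gradLen.continuous)
    refine h.trans ((mul_le_mul (ip_gradLen_le pa hma') (ip_gradLen_le pb hmb')
      (ip_self_nonneg _) (by positivity)).trans (le_of_eq ?_))
    ring
  exact hint.trans (lowerOrder_scalar hR hYa hab ma0 mb0 ma2 mb2
    hW2 (grad a P pa haR (by linarith)) (grad b Q pb hbR (by linarith)))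

/-! ### Discrete Lyapunov arguments -/

/-- Absorption of the gradient term of the energy inequality:
`2 c ‖∇b‖² ≤ γ ‖Δb‖² + (c² / γ) ‖b‖²`. -/
lemma two_mul_le_of_sq_le {γ c B Y H : ℝ} (hγ : 0 < γ) (hB : 0 ≤ B) (hY : 0 ≤ Y)
    (hH : H ^ 2 ≤ B * Y) : 2 * c * H ≤ γ * Y + c ^ 2 / γ * B := by
  refine le_trans (le_abs_self _) (abs_le_of_sq_le_sq ?_ (by positivity))
  have e : (γ * Y + c ^ 2 / γ * B) ^ 2 = (γ * Y - c ^ 2 / γ * B) ^ 2 + 4 * c ^ 2 * (B * Y) := by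
    field_simp
    ring
  have := mul_le_mul_of_nonneg_left hH (sq_nonneg c)
  nlinarith [sq_nonneg (γ * Y - c ^ 2 / γ * B)]

/-- The energy inequality does not let `‖b‖²` grow once it exceeds a threshold `K`. If it did grow,
then `‖b - a‖² ≲ Δt ‖b‖²` and `‖∇b‖² ≲ ‖b‖²`, so that for small `Δt` the Poincaré inequality yields
a nonlinear damping `∫ a² |∇b|²` of order `‖b‖⁴`, which wins against the linear instability. Here
`A`, `B`, `D`, `Y`, `G`, `H` stand for `‖a‖²`, `‖b‖²`, `‖b - a‖²`, `‖Δb‖²`, `∫ a² |∇b|²`,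
`‖∇b‖²`. -/
lemma exists_absorbing {γ γ₂ c k₁ k₂ : ℝ} (hγ : 0 < γ) (hγ₂ : 0 < γ₂) (hc : 0 < c) (hk₁ : 0 < k₁)
    (hk₂ : 0 < k₂) : ∃ τ K : ℝ, 0 < τ ∧ 0 < K ∧ ∀ Δt A B D Y G H : ℝ, 0 < Δt → Δt ≤ τ →
      0 ≤ B → 0 ≤ D → 0 ≤ Y → 0 ≤ G → 0 ≤ H → H ^ 2 ≤ B * Y → B ^ 2 ≤ k₁ * G + k₂ * (H * D) →
      B - A + D + 2 * Δt * (γ * Y + γ₂ * G - c * H) ≤ 0 → B ≤ max A K := by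
  -- `τ` is chosen so that `k₂ H D ≤ B² / 2`, and `K` so that `k₁ G ≤ K B / 2`, once `B > A`.
  refine ⟨γ ^ 2 / (2 * k₂ * c ^ 3), k₁ * c ^ 2 / (γ * γ₂), by positivity, by positivity, ?_⟩
  intro Δt A B D Y G H hΔt hτ hB hD hY hG hH hHB hBG hE
  by_contra! hcon
  obtain ⟨hBA, hBK⟩ := max_lt_iff.1 hcon
  have hB0 : 0 < B := lt_of_le_of_lt (by positivity) hBK
  have hyoung := two_mul_le_of_sq_le (c := c) hγ hB hY hHB
  have hE2 : D + Δt * (γ * Y + 2 * γ₂ * G) < Δt * (c ^ 2 / γ * B) := by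
    have := mul_le_mul_of_nonneg_left hyoung hΔt.le
    linarith
  have hYG : γ * Y + 2 * γ₂ * G < c ^ 2 / γ * B := lt_of_mul_lt_mul_left (by linarith) hΔt.le
  have hDB : D ≤ Δt * (c ^ 2 / γ * B) := by
    have : 0 ≤ Δt * (γ * Y + 2 * γ₂ * G) := by positivity
    linarith
  have hYB : Y ≤ (c / γ) ^ 2 * B := by
    have h1 : γ * Y ≤ c ^ 2 / γ * B := by
      have : 0 ≤ 2 * γ₂ * G := by positivity
      linarith
    rw [mul_comm, ← le_div_iff₀ hγ] at h1
    refine h1.trans (le_of_eq ?_)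
    field_simp
  have hHB' : H ≤ c / γ * B := by
    refine le_of_sq_le_sq (hHB.trans ?_) (by positivity)
    refine (mul_le_mul_of_nonneg_left hYB hB).trans (le_of_eq ?_)
    ring
  have hGB : k₁ * G ≤ k₁ * c ^ 2 / (2 * γ * γ₂) * B := by
    have h1 : 2 * γ₂ * G ≤ c ^ 2 / γ * B := by
      have : 0 ≤ γ * Y := by positivity
      linarith
    have h2 : G ≤ c ^ 2 / γ * B / (2 * γ₂) := by
      rw [le_div_iff₀ (by positivity)]
      linarith
    refine (mul_le_mul_of_nonneg_left h2 hk₁.le).trans (le_of_eq ?_)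
    field_simp
  have hHD : k₂ * (H * D) ≤ B ^ 2 / 2 := by
    have h1 : D ≤ γ ^ 2 / (2 * k₂ * c ^ 3) * (c ^ 2 / γ * B) :=
      hDB.trans (mul_le_mul_of_nonneg_right hτ (by positivity))
    have h2 := mul_le_mul hHB' h1 hD (by positivity)
    refine (mul_le_mul_of_nonneg_left h2 hk₂.le).trans (le_of_eq ?_)
    field_simp
  have hfin : B * B ≤ k₁ * c ^ 2 / (γ * γ₂) * B := by
    have e : k₁ * c ^ 2 / (γ * γ₂) * B = 2 * (k₁ * c ^ 2 / (2 * γ * γ₂) * B) := by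
      field_simp
    rw [e]
    linarith [sq B]
  exact absurd (le_of_mul_le_mul_right hfin hB0) (not_le.2 hBK)

/-- The functional `log (1 + ‖Δu‖²) + l ‖u‖²` does not grow once it exceeds a threshold: the
dissipation `γ Δt ‖Δb‖²` in the `L²` estimate pays for the increment of the logarithm. Here `A`,
`B`, `X`, `Y` stand for `‖a‖²`, `‖b‖²`, `‖Δa‖²`, `‖Δb‖²`. -/
lemma log_add_le_max {γ κ C R Δt A B X Y l : ℝ} (hκ : 0 ≤ κ) (hC : 0 ≤ C)
    (hΔt : 0 < Δt) (hX : 0 ≤ X) (hY : 0 ≤ Y) (hl : 0 ≤ l) (hlγ : l * γ = κ + 1)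
    (hBR : B ≤ R) (hE : B + Δt * (γ * Y) ≤ A + Δt * (C * B))
    (hXY : X ≤ Y → Y ≤ X + Δt * κ * ((1 + X) * (1 + Y))) :
    Real.log (1 + Y) + l * B
      ≤ max (Real.log (1 + X) + l * A) (Real.log (1 + (κ + l * (C * R))) + l * R) := by
  have hlog : Real.log (1 + Y) - Real.log (1 + X) ≤ Δt * κ * (1 + Y) := by
    rcases le_total X Y with h | h
    · have hX1 : 0 < 1 + X := by linarith
      -- `log t ≤ t - 1` leaves the factor `1 + Y` of the new step, which the dissipation controls.
      rw [← Real.log_div (by linarith) (by linarith)]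
      refine (Real.log_le_sub_one_of_pos (by positivity)).trans ?_
      rw [sub_le_iff_le_add, div_le_iff₀ hX1]
      linarith [hXY h]
    · have h1 : Real.log (1 + Y) ≤ Real.log (1 + X) := Real.log_le_log (by linarith) (by linarith)
      have h2 : 0 ≤ Δt * κ * (1 + Y) := by positivity
      linarith
  rcases le_total (κ + l * (C * R)) Y with h | h
  · refine le_max_of_le_left ?_
    have h1 := mul_le_mul_of_nonneg_left hE hl
    have h2 : l * (Δt * (C * B)) ≤ l * (Δt * (C * R)) := by gcongr
    have h3 : l * (Δt * (γ * Y)) = Δt * ((κ + 1) * Y) := by rw [← hlγ]; ring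
    have h4 := mul_le_mul_of_nonneg_left h hΔt.le
    nlinarith
  · refine le_max_of_le_right ?_
    have h1 : Real.log (1 + Y) ≤ Real.log (1 + (κ + l * (C * R))) :=
      Real.log_le_log (by linarith) (by linarith)
    have h2 : l * B ≤ l * R := mul_le_mul_of_nonneg_left hBR hl
    linarith

lemma lowerOrderConst_nonneg (γ₁ γ₂ : ℝ) {R : ℝ} (hR : 0 ≤ R) : 0 ≤ lowerOrderConst γ₁ γ₂ R := by
  unfold lowerOrderConst
  positivity

/-- A uniform bound on `‖u k‖²` and `‖Δ (u k)‖²` for solutions of the scheme. -/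
lemma exists_bound (γ γ₁ γ₂ : ℝ) (hγ : 0 < γ) (hγ₂ : 0 < γ₂) :
    ∃ τ : ℝ, 0 < τ ∧ ∀ u₀ : ℝ × ℝ → ℝ, MemH2 u₀ → MemH10 u₀ → ∃ R E : ℝ, 0 < R ∧ 0 < E ∧
      ∀ (m : ℕ) (T : ℝ) (M : ℕ) (u : ℕ → ℝ × ℝ → ℝ), 0 < T → 1 ≤ M → T / M ≤ τ →
        IsDiscreteSolution γ γ₁ γ₂ m T M u₀ u →
        ∀ k ≤ M, ip (u k) (u k) ≤ R ∧ ip (lap (u k)) (lap (u k)) ≤ E := by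
  set c := 1 + γ₁ ^ 2 / (2 * γ₂) with hc
  have hc0 : 0 < c := by positivity
  obtain ⟨τ, K, hτ, hK, habs⟩ := exists_absorbing (k₁ := 32 * Real.pi ^ 4)
    (k₂ := 8 * Real.pi ^ 2) hγ hγ₂ hc0 (by positivity) (by positivity)
  refine ⟨τ, hτ, fun u₀ h2 h10 => ?_⟩
  obtain ⟨R₀, hR₀⟩ := exists_proj_bound h2 h10
  set R := max R₀ K with hR
  have hR0 : 0 < R := hK.trans_le (le_max_right _ _)
  set κ := lowerOrderConst γ₁ γ₂ R / (2 * γ) with hκ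
  have hκ0 : 0 ≤ κ := div_nonneg (lowerOrderConst_nonneg γ₁ γ₂ hR0.le) (by positivity)
  set l := (κ + 1) / γ with hl
  have hl0 : 0 ≤ l := by positivity
  have hlγ : l * γ = κ + 1 := by rw [hl]; field_simp
  set C := c ^ 2 / γ with hC
  have hC0 : 0 ≤ C := by positivity
  set F := max (Real.log (1 + R) + l * R) (Real.log (1 + (κ + l * (C * R))) + l * R) with hF
  refine ⟨R, Real.exp F, hR0, Real.exp_pos _, ?_⟩
  intro m T M u hT hM hTM ⟨hu0, hum, hstep⟩
  have hΔt : 0 < T / M := div_pos hT (by exact_mod_cast hM)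
  have main : ∀ k ≤ M, ip (u k) (u k) ≤ R ∧
      Real.log (1 + ip (lap (u k)) (lap (u k))) + l * ip (u k) (u k) ≤ F := by
    intro k
    induction k with
    | zero =>
      intro _
      obtain ⟨h1, h2⟩ := hR₀ m _ hu0
      have h3 := h1.trans (le_max_left R₀ K)
      have h4 := h2.trans (le_max_left R₀ K)
      refine ⟨h3, le_max_of_le_left (add_le_add (Real.log_le_log ?_ ?_) ?_)⟩
      · linarith [ip_self_nonneg (lap (u 0))]
      · linarith
      · exact mul_le_mul_of_nonneg_left h3 hl0
    | succ k ih =>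
      intro hk
      obtain ⟨ihR, ihF⟩ := ih (by omega)
      have hs := hstep k (by omega)
      have ma := hum k (by omega)
      have mb := hum (k + 1) hk
      have pa := per_of_mem_specSpace ma
      have pb := per_of_mem_specSpace mb
      set a := u k
      set b := u (k + 1)
      have hE := hs.energy hγ₂ hΔt pa mb
      have hG : 0 ≤ ip (a * gradLen b) a := integral_nonneg fun p => by
        have hg : 0 ≤ gradLen b p := add_nonneg (mul_self_nonneg _) (mul_self_nonneg _)
        have e : (a * gradLen b) p * a p = a p ^ 2 * gradLen b p := by
          simp only [Pi.mul_apply]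
          ring
        rw [e]
        positivity
      have hH := gradSq_sq_le pb
      have hD := ip_self_nonneg (b - a)
      have hY := ip_self_nonneg (lap b)
      have hB := ip_self_nonneg b
      have hbR : ip b b ≤ R :=
        (habs _ _ _ _ _ _ _ hΔt hTM hB hD hY hG (gradSq_nonneg b) hH
          (ip_self_sq_le pa pb (eq_zero_of_mem_specSpace mb).1) hE).trans
          (max_le ihR (le_max_right _ _))
      refine ⟨hbR, (log_add_le_max hκ0 hC0 hΔt (ip_self_nonneg (lap a)) hY hl0 hlγ hbR
        ?_ ?_).trans (max_le ihF (le_max_right _ _))⟩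
      · have h1 := mul_le_mul_of_nonneg_left (two_mul_le_of_sq_le (c := c) hγ hB hY hH) hΔt.le
        have h2 : 0 ≤ T / M * (γ₂ * ip (a * gradLen b) a) := by positivity
        rw [hC]
        linarith
      · intro hab
        refine (hs.lap_le hγ hΔt pa mb).trans (add_le_add_right ?_ _)
        have h1 := ip_lowerOrder_le (γ₁ := γ₁) (γ₂ := γ₂) ma mb hR0.le ihR hbR hab
        refine (mul_le_mul_of_nonneg_left h1 (by positivity)).trans (le_of_eq ?_)
        rw [hκ]
        ring
  intro k hk
  obtain ⟨h1, h2⟩ := main k hk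
  refine ⟨h1, ?_⟩
  have hY := ip_self_nonneg (lap (u k))
  have h3 : Real.log (1 + ip (lap (u k)) (lap (u k))) ≤ F := by
    have := mul_nonneg hl0 (ip_self_nonneg (u k))
    linarith
  rw [Real.log_le_iff_le_exp (by linarith)] at h3
  linarith

/-! ### Passage to norms -/

lemma eLpNorm_two_le {f : ℝ × ℝ → ℝ} (hf : Continuous f) {S : ℝ} (hS : ip f f ≤ S) :
    eLpNorm f 2 area ≤ ENNReal.ofReal (Real.sqrt S) := by
  rw [(memLp_of_continuous hf).eLpNorm_eq_integral_rpow_norm (by norm_num) (by norm_num)]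
  refine ENNReal.ofReal_le_ofReal ?_
  have e : ∫ p, ‖f p‖ ^ (2 : ENNReal).toReal ∂area = ip f f := by simp [ip, ← sq]
  rw [e, Real.sqrt_eq_rpow]
  simp only [ENNReal.toReal_ofNat, one_div]
  exact Real.rpow_le_rpow (ip_self_nonneg f) hS (by norm_num)

lemma eLpNorm_grad_le {u : ℝ × ℝ → ℝ} (hu : Per u) {S : ℝ} (hS : gradSq u ≤ S) :
    eLpNorm (grad u) 2 area ≤ ENNReal.ofReal (Real.sqrt S) := by
  have hn : ∀ p, ‖grad u p‖ = Real.sqrt (gradLen u p) := fun p => by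
    rw [EuclideanSpace.norm_eq]
    simp [grad, gradLen, Fin.sum_univ_two, sq]
  rw [← eLpNorm_norm]
  simp only [hn]
  refine eLpNorm_two_le hu.gradLen.continuous.sqrt (le_trans (le_of_eq ?_) hS)
  rw [gradSq_eq_integral hu, ip]
  refine integral_congr_ae (.of_forall fun p => Real.mul_self_sqrt ?_)
  exact add_nonneg (mul_self_nonneg _) (mul_self_nonneg _)

lemma eLpNorm_top_le {f : ℝ × ℝ → ℝ} {S : ℝ} (hS : ∀ p ∈ square, f p ^ 2 ≤ S) :
    eLpNorm f ∞ area ≤ ENNReal.ofReal (Real.sqrt S) := by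
  rw [eLpNorm_exponent_top]
  refine eLpNormEssSup_le_of_ae_bound ((ae_restrict_iff' measurableSet_square).2
    (.of_forall fun p hp => ?_))
  exact Real.abs_le_sqrt (hS p hp)

end CCH

theorem lemma10 (γ γ₁ γ₂ : ℝ) (hγ : 0 < γ) (hγ₂ : 0 < γ₂) :
    ∃ τ₀ : ℝ, 0 < τ₀ ∧
      ∀ u₀ : ℝ × ℝ → ℝ, CCH.MemH2 u₀ → CCH.MemH10 u₀ →
        ∃ c₁₅ c₁₆ c₁₇ c₁₈ : ℝ, 0 < c₁₅ ∧ 0 < c₁₆ ∧ 0 < c₁₇ ∧ 0 < c₁₈ ∧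
          ∀ (m : ℕ) (T : ℝ) (M : ℕ) (u : ℕ → ℝ × ℝ → ℝ),
            1 ≤ m → 0 < T → 1 ≤ M → T / M ≤ τ₀ →
            CCH.IsDiscreteSolution γ γ₁ γ₂ m T M u₀ u →
            ∀ k ≤ M,
              eLpNorm (u k) 2 CCH.area ≤ ENNReal.ofReal c₁₅ ∧
              eLpNorm (CCH.grad (u k)) 2 CCH.area ≤ ENNReal.ofReal c₁₆ ∧
              eLpNorm (CCH.lap (u k)) 2 CCH.area ≤ ENNReal.ofReal c₁₇ ∧
              eLpNorm (u k) ∞ CCH.area ≤ ENNReal.ofReal c₁₈ := by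
  obtain ⟨τ, hτ, h⟩ := CCH.exists_bound γ γ₁ γ₂ hγ hγ₂
  refine ⟨τ, hτ, fun u₀ h2 h10 => ?_⟩
  obtain ⟨R, E, hR, hE, hRE⟩ := h u₀ h2 h10
  refine ⟨Real.sqrt R, Real.sqrt (Real.sqrt (R * E)), Real.sqrt E,
    Real.sqrt (Real.sqrt (6 * (R * E))), by positivity, by positivity, by positivity,
    by positivity, ?_⟩
  intro m T M u _ hT hM hTM hu k hk
  have hmem := hu.2.1 k hk
  have pu := CCH.per_of_mem_specSpace hmem
  obtain ⟨hB, hY⟩ := hRE m T M u hT hM hTM hu k hk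
  have hBY : CCH.ip (u k) (u k) * CCH.ip (CCH.lap (u k)) (CCH.lap (u k)) ≤ R * E :=
    mul_le_mul hB hY (CCH.ip_self_nonneg _) hR.le
  refine ⟨CCH.eLpNorm_two_le pu.continuous hB, CCH.eLpNorm_grad_le pu ?_,
    CCH.eLpNorm_two_le pu.lap.continuous hY, CCH.eLpNorm_top_le fun p hp => ?_⟩
  · exact Real.le_sqrt_of_sq_le ((CCH.gradSq_sq_le pu).trans hBY)
  · obtain ⟨h1, h2⟩ := CCH.eq_zero_of_mem_specSpace hmem
    refine Real.le_sqrt_of_sq_le ((CCH.pow_four_le pu h1 h2 hp).trans ?_)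
    exact mul_le_mul_of_nonneg_left hBY (by norm_num)
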